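/- Let $n\ge 1$, $1\le p<\infty$, $1\le q<\infty$. Let $f:\mathbb R^n\to\mathbb R^n$ be a homeomorphism of $\mathbb R^n$ onto $\mathbb R^n$ such that $f\in W^{1,p}_{\rm loc}(\mathbb R^n,\mathbb R^n)$ and $f^{-1}\in W^{1,q}_{\rm loc}(\mathbb R^n,\mathbb R^n)$. Let $Df$ be (any representative of) the weak derivative of $f$, let $J_f=\det Df$, let $\mathbb B^n$ be the open unit ball of $\mathbb R^n$, and let $\mathcal R=\operatorname{Diag}(1,\ldots,1,-1)$ be the reflection in the last coordinate, $x\mapsto \mathcal R x$. Then for almost every point $x_o$ of the set $\{x\in\mathbb R^n:\ J_f(x)<0\}$ there is a linear transformation $A:\mathbb R^n\to\mathbb R^n$ with $\det A>0$ such that the homeomorphism $g=A\circ f$ satisfies $$ \lim_{r\to 0^+}\Vert g_r-\mathcal R\Vert_{W^{1,p}(\mathbb B^n,\mathbb R^n)}= \lim_{r\to 0^+}\Vert (g_r)^{-1}-\mathcal R\Vert_{W^{1,q}(\mathbb B^n,\mathbb R^n)}=0, $$ where $$ g_r(x)=\frac{g(x_o+rx)-g(x_o)}{r},\qquad r>0,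 $$ and $(g_r)^{-1}$ is the inverse of the homeomorphism $g_r:\mathbb R^n\to\mathbb R^n$. Here $\Vert u\Vert_{W^{1,s}(\mathbb B^n,\mathbb R^n)}=\bigl(\int_{\mathbb B^n}|u|^s+|Du|^s\,dx\bigr)^{1/s}$. -/

import Mathlib

open MeasureTheory Filter Topology

section SobolevSpaces

variable {E F : Type*} [NormedAddCommGroup E] [NormedSpace ℝ E] [MeasureSpace E]
  [NormedAddCommGroup F] [NormedSpace ℝ F]

/-- `Du` is a weak (distributional) derivative of `u` on the open set `Ω`: both are locally
integrable on `Ω`, and integration by parts holds against every test function `φ ∈ C_c^∞(Ω)`,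
in every direction `v`. -/
structure HasWeakFDerivOn (Ω : Set E) (u : E → F) (Du : E → E →L[ℝ] F) : Prop where
  locallyIntegrableOn : LocallyIntegrableOn u Ω volume
  locallyIntegrableOn_deriv : LocallyIntegrableOn Du Ω volume
  integral_eq : ∀ φ : E → ℝ, ContDiff ℝ ((⊤ : ℕ∞) : WithTop ℕ∞) φ → HasCompactSupport φ →
    tsupport φ ⊆ Ω → ∀ v : E,
      ∫ x in Ω, (fderiv ℝ φ x v) • u x = - ∫ x in Ω, φ x • (Du x v)

/-- `u ∈ W^{1,p}_loc(Ω, F)`. -/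
def MemSobolevLoc (p : ENNReal) (Ω : Set E) (u : E → F) : Prop :=
  ∃ Du : E → E →L[ℝ] F, HasWeakFDerivOn Ω u Du ∧
    ∀ K : Set E, K ⊆ Ω → IsCompact K →
      MemLp u p (volume.restrict K) ∧ MemLp Du p (volume.restrict K)

/-- The norm of `W^{1,p}(Ω, F)`, `1 ≤ p < ∞`,
`‖u‖ = (∫_Ω |u|^p + |Du|^p)^{1/p}`, with value `∞` when `u` is not in `W^{1,p}(Ω, F)`.
Weak derivatives are unique up to null sets, so the infimum only removes the choice of a
representative of `Du` (and is `∞` if there is no weak derivative). -/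
noncomputable def sobolevENorm (p : ENNReal) (Ω : Set E) (u : E → F) : ENNReal :=
  ⨅ (Du : E → E →L[ℝ] F) (_ : HasWeakFDerivOn Ω u Du),
    (eLpNorm u p (volume.restrict Ω) ^ p.toReal +
      eLpNorm Du p (volume.restrict Ω) ^ p.toReal) ^ (1 / p.toReal)

end SobolevSpaces

section BlowUp

variable {E : Type*} [NormedAddCommGroup E] [NormedSpace ℝ E]

/-- The rescaling `g_r(x) = (g(x₀ + r x) - g(x₀)) / r` of `g` at `x₀`. -/
noncomputable def blowUp (g : E → E) (x₀ : E) (r : ℝ) : E → E :=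
  fun x => r⁻¹ • (g (x₀ + r • x) - g x₀)

/-- The rescalings of a bijection are bijections, so that `Function.invFun (blowUp g x₀ r)` is
the genuine inverse map `(g_r)⁻¹`. -/
theorem blowUp_bijective {g : E → E} (hg : Function.Bijective g) (x₀ : E) {r : ℝ} (hr : 0 < r) :
    Function.Bijective (blowUp g x₀ r) := by
  have hr0 : r ≠ 0 := hr.ne'
  constructor
  · intro x y hxy
    have h1 := smul_right_injective E (inv_ne_zero hr0) hxy
    have h2 := hg.1 (sub_left_injective h1)
    exact smul_right_injective E hr0 (add_right_injective x₀ h2)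
  · intro y
    obtain ⟨z, hz⟩ := hg.2 (g x₀ + r • y)
    refine ⟨r⁻¹ • (z - x₀), ?_⟩
    simp [blowUp, smul_smul, hr0, hz]

end BlowUp

/-- The reflection `Diag(1, …, 1, -1)` in the last coordinate of `ℝⁿ`. -/
noncomputable def lastReflection (n : ℕ) :
    EuclideanSpace ℝ (Fin n) →L[ℝ] EuclideanSpace ℝ (Fin n) :=
  Matrix.toEuclideanCLM (𝕜 := ℝ)
    (Matrix.diagonal fun i : Fin n => if (i : ℕ) + 1 = n then (-1 : ℝ) else 1)

/-!
The proof rests on two facts about a continuous Sobolev map `u` with weak derivative `Du`.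

*Blow-up at Lebesgue points.* Let `x` be a Lebesgue point of `Du` in the sense of `L^P` means. Then
`u` has the first order expansion with linear part `Du x` at `x`, in the mean of order `P` over
balls, with error `o(r)`: for a smooth map this is the fundamental theorem of calculus along the
rays issuing from `x`, and the general case follows by mollification
(`HasWeakFDerivOn.setLIntegral_sub_center_le`, `HasWeakFDerivOn.isLpApproxPoint`). Both conditions
together say that the rescalings of `u` at `x` converge to `Du x` in `W^{1,P}` of every ball
(`IsLpApproxPoint.tendsto_sobolevENorm_blowUp`). Almost every point is such a point.

*The derivative of the inverse.* It remains to see that, for almost every `x` with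
`det (Df x) ≠ 0`, the image `f x` is a good point for `f⁻¹` and the weak derivative of `f⁻¹` at `f x`
is the inverse of `Df x`. The whole space is, up to a null set, a countable union of sets on which
the mean oscillation of `f` over balls of radius `r` is at most a constant times `r`. Relative to
such a set, differentiability in the mean is classical differentiability
(`IsLpApproxPoint.hasFDerivWithinAt`). Hence `f⁻¹` is classically differentiable relative to the
image of the part where `det (Df) ≠ 0`, so it maps null subsets of this image to null sets
(`HasWeakFDerivOn.ae_notMem_of_det_ne_zero`); and the chain rule relative to sets of this kind,
at their density points, gives the formula for the derivative
(`HasWeakFDerivOn.ae_comp_eq_id`).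

With `R` the reflection and `L = Df x₀`, the linear map `A = R L⁻¹` has positive determinant when
`det L < 0`. The rescalings of `A ∘ f` at `x₀` converge to `A L = R`, and their inverses, which are
the rescalings of `f⁻¹` at `f x₀` precomposed with `A⁻¹`, converge to `L⁻¹ A⁻¹ = R`.
-/

set_option linter.unusedSectionVars false

open Metric Module
open scoped Convolution ENNReal

/-! ### Calculus of weak derivatives -/

section WeakDerivative

variable {E F G : Type*} [NormedAddCommGroup E] [NormedSpace ℝ E] [FiniteDimensional ℝ E]
  [MeasureSpace E] [BorelSpace E] [(volume : Measure E).IsAddHaarMeasure]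
  [NormedAddCommGroup F] [NormedSpace ℝ F] [FiniteDimensional ℝ F]
  [NormedAddCommGroup G] [NormedSpace ℝ G] [FiniteDimensional ℝ G]

theorem ContinuousLinearMap.comp_locallyIntegrable {F G : Type*} [NormedAddCommGroup F]
    [NormedSpace ℝ F] [NormedAddCommGroup G] [NormedSpace ℝ G] {u : E → F}
    (L : F →L[ℝ] G) (hu : LocallyIntegrable u volume) :
    LocallyIntegrable (fun x => L (u x)) volume := fun x => by
  obtain ⟨s, hs, hi⟩ := hu x
  exact ⟨s, hs, L.integrable_comp hi⟩

/-- The homeomorphism `x ↦ x₀ + T x`. -/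
def translateCompHomeomorph (x₀ : E) (T : E ≃L[ℝ] E) : E ≃ₜ E :=
  T.toHomeomorph.trans (Homeomorph.addLeft x₀)

theorem translateCompHomeomorph_apply (x₀ : E) (T : E ≃L[ℝ] E) (x : E) :
    translateCompHomeomorph x₀ T x = x₀ + T x := rfl

/-- The affine change of variables `x ↦ x₀ + T x` multiplies Lebesgue measure by a constant. -/
theorem map_translateCompHomeomorph_volume (x₀ : E) (T : E ≃L[ℝ] E) :
    Measure.map (translateCompHomeomorph x₀ T) (volume : Measure E)
      = ENNReal.ofReal |(LinearMap.det (T : E →ₗ[ℝ] E))⁻¹| • volume := by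
  have h1 : Measure.map T (volume : Measure E)
      = ENNReal.ofReal |(LinearMap.det (T : E →ₗ[ℝ] E))⁻¹| • volume :=
    Measure.map_linearMap_addHaar_eq_smul_addHaar _
      (LinearEquiv.isUnit_det' T.toLinearEquiv).ne_zero
  have h2 : ⇑(translateCompHomeomorph x₀ T) = (fun x => x₀ + x) ∘ T := rfl
  rw [h2, ← Measure.map_map (measurable_const_add x₀) T.continuous.measurable, h1,
    Measure.map_smul, (measurePreserving_add_left volume x₀).map_eq]

theorem MeasureTheory.LocallyIntegrable.comp_affine {F : Type*} [NormedAddCommGroup F]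
    {u : E → F} (hu : LocallyIntegrable u volume) (x₀ : E) (T : E ≃L[ℝ] E) :
    LocallyIntegrable (fun x => u (x₀ + T x)) volume := by
  have : LocallyIntegrable u (Measure.map (translateCompHomeomorph x₀ T) volume) := by
    rw [map_translateCompHomeomorph_volume]
    intro x
    obtain ⟨s, hs, hi⟩ := hu x
    refine ⟨s, hs, ?_⟩
    rw [IntegrableOn, Measure.restrict_smul]
    exact hi.smul_measure ENNReal.ofReal_ne_top
  exact (locallyIntegrable_map_homeomorph _).1 this

theorem integral_comp_affine {F : Type*} [NormedAddCommGroup F] [NormedSpace ℝ F]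
    (x₀ : E) (T : E ≃L[ℝ] E) (g : E → F) :
    ∫ x, g (x₀ + T x) = |(LinearMap.det (T : E →ₗ[ℝ] E))⁻¹| • ∫ x, g x := by
  have := (translateCompHomeomorph x₀ T).measurableEmbedding.integral_map (μ := volume) g
  rw [map_translateCompHomeomorph_volume, integral_smul_measure,
    ENNReal.toReal_ofReal (abs_nonneg _)] at this
  exact this.symm

namespace HasWeakFDerivOn

variable {u : E → F} {Du Du' : E → E →L[ℝ] F}

theorem locallyIntegrable (h : HasWeakFDerivOn Set.univ u Du) : LocallyIntegrable u volume :=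
  locallyIntegrableOn_univ.1 h.locallyIntegrableOn

theorem locallyIntegrable_deriv (h : HasWeakFDerivOn Set.univ u Du) :
    LocallyIntegrable Du volume :=
  locallyIntegrableOn_univ.1 h.locallyIntegrableOn_deriv

theorem integral_eq_univ (h : HasWeakFDerivOn Set.univ u Du) {φ : E → ℝ}
    (hφ : ContDiff ℝ ((⊤ : ℕ∞) : WithTop ℕ∞) φ) (hc : HasCompactSupport φ) (v : E) :
    ∫ x, (fderiv ℝ φ x v) • u x = - ∫ x, φ x • (Du x v) := by
  simpa using h.integral_eq φ hφ hc (Set.subset_univ _) v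

/-- Weak derivatives are unique up to null sets. -/
theorem ae_eq (h : HasWeakFDerivOn Set.univ u Du) (h' : HasWeakFDerivOn Set.univ u Du') :
    Du =ᵐ[volume] Du' := by
  refine ae_eq_of_integral_contDiff_smul_eq h.locallyIntegrable_deriv h'.locallyIntegrable_deriv ?_
  intro φ hφ hc
  have i1 := h.locallyIntegrable_deriv.integrable_smul_left_of_hasCompactSupport hφ.continuous hc
  have i2 := h'.locallyIntegrable_deriv.integrable_smul_left_of_hasCompactSupport hφ.continuous hc
  ext1 v
  rw [ContinuousLinearMap.integral_apply i1, ContinuousLinearMap.integral_apply i2]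
  have := (h.integral_eq_univ hφ hc v).symm.trans (h'.integral_eq_univ hφ hc v)
  simpa using neg_injective this

theorem congr_ae (h : HasWeakFDerivOn Set.univ u Du) (h' : Du =ᵐ[volume] Du') :
    HasWeakFDerivOn Set.univ u Du' where
  locallyIntegrableOn := h.locallyIntegrableOn
  locallyIntegrableOn_deriv :=
    locallyIntegrableOn_univ.2 fun x => by
      obtain ⟨s, hs, hi⟩ := locallyIntegrableOn_univ.1 h.locallyIntegrableOn_deriv x
      exact ⟨s, hs, hi.congr (ae_restrict_of_ae h')⟩
  integral_eq φ hφ hc hs v := by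
    rw [h.integral_eq φ hφ hc hs v]
    congr 1
    refine setIntegral_congr_ae₀ MeasurableSet.univ.nullMeasurableSet ?_
    filter_upwards [h'] with x hx _
    rw [hx]

/-- A weak derivative on the whole space is one on every subset: test functions supported in the
subset are unaffected by restricting the integrals. -/
theorem restrict (h : HasWeakFDerivOn Set.univ u Du) (Ω : Set E) :
    HasWeakFDerivOn Ω u Du where
  locallyIntegrableOn := h.locallyIntegrable.locallyIntegrableOn Ω
  locallyIntegrableOn_deriv := h.locallyIntegrable_deriv.locallyIntegrableOn Ω
  integral_eq φ hφ hc hs v := by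
    rw [setIntegral_eq_integral_of_forall_compl_eq_zero,
      setIntegral_eq_integral_of_forall_compl_eq_zero, h.integral_eq_univ hφ hc]
    · intro x hx
      rw [image_eq_zero_of_notMem_tsupport (fun hx' => hx (hs hx')), zero_smul]
    · intro x hx
      have : x ∉ tsupport (fderiv ℝ φ) := fun hx' => hx (hs (tsupport_fderiv_subset ℝ hx'))
      rw [image_eq_zero_of_notMem_tsupport this]
      simp

/-- Chain rule for composition with a linear map on the left and an affine isomorphism on the
right. -/
theorem comp_affine (h : HasWeakFDerivOn Set.univ u Du) (B : F →L[ℝ] G) (x₀ : E)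
    (T : E ≃L[ℝ] E) :
    HasWeakFDerivOn Set.univ (fun x => B (u (x₀ + T x)))
      (fun x => B ∘L Du (x₀ + T x) ∘L (T : E →L[ℝ] E)) where
  locallyIntegrableOn := locallyIntegrableOn_univ.2
    ((B.comp_locallyIntegrable h.locallyIntegrable).comp_affine x₀ T)
  locallyIntegrableOn_deriv := by
    refine locallyIntegrableOn_univ.2 ?_
    let L : (E →L[ℝ] F) →L[ℝ] (E →L[ℝ] G) :=
      (ContinuousLinearMap.compL ℝ E F G B) ∘L
        ((ContinuousLinearMap.compL ℝ E E F).flip (T : E →L[ℝ] E))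
    exact (L.comp_locallyIntegrable h.locallyIntegrable_deriv).comp_affine x₀ T
  integral_eq φ hφ hc _ v := by
    let ψ : E → ℝ := fun z => φ (T.symm (z - x₀))
    have hψ : ContDiff ℝ ((⊤ : ℕ∞) : WithTop ℕ∞) ψ :=
      hφ.comp (T.symm.contDiff.comp (contDiff_id.sub contDiff_const))
    have hψc : HasCompactSupport ψ := by
      have := hc.comp_homeomorph (translateCompHomeomorph x₀ T).symm
      have hψe : ψ = φ ∘ (translateCompHomeomorph x₀ T).symm := by
        funext z
        obtain ⟨y, rfl⟩ := (translateCompHomeomorph x₀ T).surjective z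
        rw [Function.comp_apply, Homeomorph.symm_apply_apply]
        simp [ψ, translateCompHomeomorph_apply]
      rwa [hψe]
    have hψT : ∀ x, ψ (x₀ + T x) = φ x := fun x => by simp [ψ]
    have hdψ : ∀ x, fderiv ℝ ψ (x₀ + T x) (T v) = fderiv ℝ φ x v := by
      intro x
      have h1 : HasFDerivAt ψ ((fderiv ℝ φ x) ∘L (T.symm : E →L[ℝ] E)) (x₀ + T x) := by
        have h2 : HasFDerivAt (fun z => T.symm (z - x₀)) (T.symm : E →L[ℝ] E) (x₀ + T x) :=
          T.symm.hasFDerivAt.comp _ ((hasFDerivAt_id _).sub_const x₀)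
        have h3 : HasFDerivAt φ (fderiv ℝ φ x) (T.symm (x₀ + T x - x₀)) := by
          rw [add_sub_cancel_left, T.symm_apply_apply]
          exact (hφ.differentiable (by simp) x).hasFDerivAt
        exact HasFDerivAt.comp (g := φ) (x₀ + T x) h3 h2
      rw [h1.fderiv]
      simp
    have key := h.integral_eq_univ hψ hψc (T v)
    have i1 : Integrable (fun z => (fderiv ℝ ψ z (T v)) • u z) volume := by
      have hcd : HasCompactSupport (fun z => fderiv ℝ ψ z (T v)) :=
        hψc.fderiv_apply (𝕜 := ℝ) (T v)
      exact h.locallyIntegrable.integrable_smul_left_of_hasCompactSupport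
        ((hψ.continuous_fderiv (by simp)).clm_apply continuous_const) hcd
    have i2 : Integrable (fun z => ψ z • (Du z (T v))) volume := by
      have := h.locallyIntegrable_deriv.integrable_smul_left_of_hasCompactSupport
        hψ.continuous hψc
      exact (ContinuousLinearMap.apply ℝ F (T v)).integrable_comp this
    have e1 := integral_comp_affine x₀ T (fun z => B ((fderiv ℝ ψ z (T v)) • u z))
    have e2 := integral_comp_affine x₀ T (fun z => B (ψ z • (Du z (T v))))
    rw [B.integral_comp_comm i1] at e1
    rw [B.integral_comp_comm i2] at e2
    simp only [hdψ, map_smul] at e1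
    simp only [hψT, map_smul] at e2
    simp only [Measure.restrict_univ]
    rw [e1, key, map_neg, smul_neg, ← e2]
    rfl

theorem sub_affine (h : HasWeakFDerivOn Set.univ u Du) (c : F) (M : E →L[ℝ] F) :
    HasWeakFDerivOn Set.univ (fun x => u x - (c + M x)) (fun x => Du x - M) where
  locallyIntegrableOn := locallyIntegrableOn_univ.2 (h.locallyIntegrable.sub
    (by fun_prop : Continuous fun x => c + M x).locallyIntegrable)
  locallyIntegrableOn_deriv := locallyIntegrableOn_univ.2 (h.locallyIntegrable_deriv.sub
    (continuous_const.locallyIntegrable))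
  integral_eq φ hφ hc _ v := by
    have key := h.integral_eq_univ hφ hc v
    have hM : ∀ x, HasFDerivAt (fun x => c + M x) M x := fun x => M.hasFDerivAt.const_add c
    have hcd : HasCompactSupport (fun z => fderiv ℝ φ z v) := hc.fderiv_apply (𝕜 := ℝ) v
    have hcont : Continuous (fun z => fderiv ℝ φ z v) :=
      (hφ.continuous_fderiv (by simp)).clm_apply continuous_const
    have hMc : Continuous fun x => c + M x := by fun_prop
    have i1 := h.locallyIntegrable.integrable_smul_left_of_hasCompactSupport hcont hcd
    have i2 : Integrable (fun z => φ z • (Du z v)) volume :=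
      (ContinuousLinearMap.apply ℝ F v).integrable_comp
        (h.locallyIntegrable_deriv.integrable_smul_left_of_hasCompactSupport hφ.continuous hc)
    have j1 := (hMc.locallyIntegrable
      (μ := (volume : Measure E))).integrable_smul_left_of_hasCompactSupport
      hcont hcd
    have j2 := ((continuous_const (y := M v)).locallyIntegrable
      (μ := (volume : Measure E))).integrable_smul_left_of_hasCompactSupport hφ.continuous hc
    have j3 := (hMc.locallyIntegrable
      (μ := (volume : Measure E))).integrable_smul_left_of_hasCompactSupport
      hφ.continuous hc
    have key2 : ∫ x, φ x • (M v) = - ∫ x, (fderiv ℝ φ x v) • (c + M x) := by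
      have := integral_smul_fderiv_eq_neg_fderiv_smul_of_integrable (μ := (volume : Measure E))
        (f := φ) (g := fun x => c + M x) (v := v) j1 (by simpa only [(hM _).fderiv] using j2) j3
        (fun x _ => hφ.differentiable (by simp) x) (fun x _ => (hM x).differentiableAt)
      simpa only [(hM _).fderiv] using this
    simp only [Measure.restrict_univ, smul_sub, sub_apply]
    rw [integral_sub i1 j1, integral_sub i2 j2, key, key2]
    abel

end HasWeakFDerivOn

end WeakDerivative

/-! ### From the oscillation of the derivative to that of the function -/

/-- Jensen's inequality for powers, for measures of mass at most one. -/
theorem lintegral_rpow_le_lintegral_rpow {α : Type*} [MeasurableSpace α] {μ : Measure α}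
    (hμ : μ Set.univ ≤ 1) {f : α → ℝ≥0∞} (hf : AEMeasurable f μ) {P : ℝ} (hP : 1 ≤ P) :
    (∫⁻ x, f x ∂μ) ^ P ≤ ∫⁻ x, f x ^ P ∂μ := by
  rcases hP.eq_or_lt with rfl | hP1
  · simp
  have hpq := Real.HolderConjugate.conjExponent hP1
  have h := ENNReal.lintegral_mul_le_Lp_mul_Lq μ hpq hf (aemeasurable_const (b := (1 : ℝ≥0∞)))
  have h1 : (∫⁻ _, (1 : ℝ≥0∞) ^ (P.conjExponent) ∂μ) ^ (1 / P.conjExponent) ≤ 1 := by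
    refine ENNReal.rpow_le_one ?_ (one_div_nonneg.2 hpq.symm.nonneg)
    simpa using hμ
  have h2 : ∫⁻ x, f x ∂μ ≤ (∫⁻ x, f x ^ P ∂μ) ^ (1 / P) := by
    calc ∫⁻ x, f x ∂μ = ∫⁻ x, (f * (fun _ => 1 : α → ℝ≥0∞)) x ∂μ := by simp
      _ ≤ _ := h
      _ ≤ (∫⁻ x, f x ^ P ∂μ) ^ (1 / P) * 1 := by gcongr
      _ = _ := mul_one _
  calc (∫⁻ x, f x ∂μ) ^ P ≤ ((∫⁻ x, f x ^ P ∂μ) ^ (1 / P)) ^ P := by gcongr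
    _ = _ := by rw [← ENNReal.rpow_mul, one_div_mul_cancel (by linarith), ENNReal.rpow_one]

theorem setLIntegral_map_of_measurableEmbedding {α β : Type*} [MeasurableSpace α]
    [MeasurableSpace β] {f : α → β} (hf : MeasurableEmbedding f) (μ : Measure α) (g : β → ℝ≥0∞)
    (s : Set β) : ∫⁻ y in s, g y ∂(Measure.map f μ) = ∫⁻ x in f ⁻¹' s, g (f x) ∂μ := by
  rw [hf.restrict_map, hf.lintegral_map]

section Poincare

variable {E F : Type*} [NormedAddCommGroup E] [NormedSpace ℝ E] [FiniteDimensional ℝ E]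
  [MeasureSpace E] [BorelSpace E] [(volume : Measure E).IsAddHaarMeasure]
  [NormedAddCommGroup F] [NormedSpace ℝ F] [FiniteDimensional ℝ F]

theorem setLIntegral_closedBall_comp_smul (g : E → ℝ≥0∞) {t : ℝ} (ht : 0 < t) (ρ : ℝ) :
    ∫⁻ z in closedBall (0 : E) ρ, g (t • z)
      = ENNReal.ofReal ((t ^ finrank ℝ E)⁻¹) * ∫⁻ z in closedBall (0 : E) (t * ρ), g z := by
  have he := (Homeomorph.smulOfNeZero t ht.ne' : E ≃ₜ E).measurableEmbedding
  have h := setLIntegral_map_of_measurableEmbedding he volume g (closedBall (0 : E) (t * ρ))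
  have hpre : (Homeomorph.smulOfNeZero t ht.ne' : E ≃ₜ E) ⁻¹' closedBall (0 : E) (t * ρ)
      = closedBall 0 ρ := by
    ext z
    simp [norm_smul, abs_of_pos ht, ht]
  have hm : Measure.map (Homeomorph.smulOfNeZero t ht.ne' : E ≃ₜ E) (volume : Measure E)
      = ENNReal.ofReal ((t ^ finrank ℝ E)⁻¹) • volume := by
    have := Measure.map_addHaar_smul (volume : Measure E) ht.ne'
    rwa [abs_of_pos (by positivity)] at this
  rw [hpre, hm, Measure.restrict_smul, lintegral_smul_measure] at h
  exact h.symm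

/-- For a `C¹` map, the difference between two points of a ray through the origin is controlled in
`L^P` of a ball by the derivative on the intermediate homothetic balls. -/
theorem setLIntegral_sub_smul_le {v : E → F} (hv : ContDiff ℝ 1 v) {P : ℝ} (hP : 1 ≤ P)
    {τ ρ : ℝ} (hτ : 0 < τ) (hτ1 : τ ≤ 1) :
    ∫⁻ z in closedBall (0 : E) ρ, ‖v z - v (τ • z)‖ₑ ^ P
      ≤ ENNReal.ofReal ρ ^ P *
        ∫⁻ t in Set.Ioc τ 1, ∫⁻ z in closedBall (0 : E) ρ, ‖fderiv ℝ v (t • z)‖ₑ ^ P := by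
  have hP0 : 0 ≤ P := by linarith
  have hdc : Continuous (fderiv ℝ v) := hv.continuous_fderiv (by simp)
  have hpt : ∀ z, ‖v z - v (τ • z)‖ₑ ^ P
      ≤ ‖z‖ₑ ^ P * ∫⁻ t in Set.Ioc τ 1, ‖fderiv ℝ v (t • z)‖ₑ ^ P := by
    intro z
    have hd : ∀ t : ℝ, HasDerivAt (fun t : ℝ => v (t • z)) (fderiv ℝ v (t • z) z) t := by
      intro t
      have h1 : HasDerivAt (fun t : ℝ => t • z) z t := by
        simpa using (hasDerivAt_id t).smul_const z
      exact (hv.differentiable (by simp) (t • z)).hasFDerivAt.comp_hasDerivAt t h1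
    have hc : Continuous fun t : ℝ => fderiv ℝ v (t • z) z := by fun_prop
    have hint := intervalIntegral.integral_eq_sub_of_hasDerivAt (a := τ) (b := 1)
      (fun t _ => hd t) (hc.intervalIntegrable _ _)
    rw [one_smul, intervalIntegral.integral_of_le hτ1] at hint
    have hmass : (volume.restrict (Set.Ioc τ 1)) Set.univ ≤ 1 := by
      rw [Measure.restrict_apply_univ, Real.volume_Ioc]
      exact ENNReal.ofReal_le_one.2 (by linarith)
    have hcm : Continuous fun t : ℝ => ‖fderiv ℝ v (t • z)‖ₑ := by fun_prop
    calc ‖v z - v (τ • z)‖ₑ ^ P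
        = ‖∫ t in Set.Ioc τ 1, fderiv ℝ v (t • z) z‖ₑ ^ P := by rw [hint]
      _ ≤ (∫⁻ t in Set.Ioc τ 1, ‖z‖ₑ * ‖fderiv ℝ v (t • z)‖ₑ) ^ P := by
        gcongr
        refine (enorm_integral_le_lintegral_enorm _).trans (lintegral_mono fun t => ?_)
        rw [mul_comm]
        exact ContinuousLinearMap.le_opENorm _ _
      _ ≤ ∫⁻ t in Set.Ioc τ 1, (‖z‖ₑ * ‖fderiv ℝ v (t • z)‖ₑ) ^ P :=
        lintegral_rpow_le_lintegral_rpow hmass (hcm.measurable.const_mul _).aemeasurable hP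
      _ = _ := by
        simp_rw [ENNReal.mul_rpow_of_nonneg _ _ hP0]
        rw [lintegral_const_mul _ (hcm.measurable.pow_const _)]
  calc ∫⁻ z in closedBall (0 : E) ρ, ‖v z - v (τ • z)‖ₑ ^ P
      ≤ ∫⁻ z in closedBall (0 : E) ρ,
          ENNReal.ofReal ρ ^ P * ∫⁻ t in Set.Ioc τ 1, ‖fderiv ℝ v (t • z)‖ₑ ^ P := by
        refine setLIntegral_mono' measurableSet_closedBall fun z hz => (hpt z).trans ?_
        gcongr
        rw [← ofReal_norm]
        exact ENNReal.ofReal_le_ofReal (by simpa using hz)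
    _ = ENNReal.ofReal ρ ^ P *
        ∫⁻ z in closedBall (0 : E) ρ, ∫⁻ t in Set.Ioc τ 1, ‖fderiv ℝ v (t • z)‖ₑ ^ P := by
        rw [lintegral_const_mul' _ _ (ENNReal.rpow_ne_top_of_nonneg hP0 ENNReal.ofReal_ne_top)]
    _ = _ := by
        congr 1
        refine lintegral_lintegral_swap ?_
        have : Continuous fun q : E × ℝ => ‖fderiv ℝ v (q.2 • q.1)‖ₑ := by fun_prop
        exact (this.measurable.pow_const P).aemeasurable

/-- Young's inequality for averaging kernels, localized to balls. -/
theorem setLIntegral_convolution_le {h : E → F} (hh : StronglyMeasurable h) {φ : E → ℝ}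
    (hφc : Continuous φ) (hφ0 : ∀ x, 0 ≤ φ x) (hφi : Integrable φ volume) (hφ1 : ∫ x, φ x = 1)
    {δ : ℝ} (hφs : Function.support φ ⊆ closedBall 0 δ) {P : ℝ} (hP : 1 ≤ P) (s : ℝ) :
    ∫⁻ x in closedBall (0 : E) s,
        ‖(φ ⋆[ContinuousLinearMap.lsmul ℝ ℝ, volume] h) x‖ₑ ^ P
      ≤ ∫⁻ x in closedBall (0 : E) (s + δ), ‖h x‖ₑ ^ P := by
  have hφm : Measurable fun y => ENNReal.ofReal (φ y) := hφc.measurable.ennreal_ofReal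
  set ν : Measure E := volume.withDensity fun y => ENNReal.ofReal (φ y) with hν
  have hν1 : ν Set.univ = 1 := by
    rw [hν, withDensity_apply _ MeasurableSet.univ, Measure.restrict_univ,
      ← ofReal_integral_eq_lintegral_ofReal hφi (ae_of_all _ hφ0), hφ1, ENNReal.ofReal_one]
  have : IsFiniteMeasure ν := ⟨by rw [hν1]; exact ENNReal.one_lt_top⟩
  have hHm : Measurable fun x => ‖h x‖ₑ ^ P := hh.enorm.pow_const P
  have hpt : ∀ x, ‖(φ ⋆[ContinuousLinearMap.lsmul ℝ ℝ, volume] h) x‖ₑ ^ P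
      ≤ ∫⁻ y, ‖h (x - y)‖ₑ ^ P ∂ν := by
    intro x
    have hm : Measurable fun y => ‖h (x - y)‖ₑ := hh.enorm.comp (measurable_const_sub x)
    refine le_trans ?_ (lintegral_rpow_le_lintegral_rpow hν1.le hm.aemeasurable hP)
    gcongr
    rw [hν, lintegral_withDensity_eq_lintegral_mul _ hφm hm]
    refine (enorm_integral_le_lintegral_enorm _).trans (lintegral_mono fun y => ?_)
    simp [enorm_smul, Real.enorm_eq_ofReal (hφ0 y)]
  have hsupp : ∀ᵐ y ∂ν, y ∈ closedBall (0 : E) δ := by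
    rw [hν, ae_withDensity_iff hφm]
    refine ae_of_all _ fun y hy => hφs ?_
    intro h0
    exact hy (by rw [h0, ENNReal.ofReal_zero])
  calc _ ≤ ∫⁻ x in closedBall (0 : E) s, ∫⁻ y, ‖h (x - y)‖ₑ ^ P ∂ν := lintegral_mono hpt
    _ = ∫⁻ y, ∫⁻ x in closedBall (0 : E) s, ‖h (x - y)‖ₑ ^ P ∂volume ∂ν := by
      refine lintegral_lintegral_swap ?_
      exact (hHm.comp (measurable_fst.sub measurable_snd)).aemeasurable
    _ ≤ ∫⁻ _, (∫⁻ x in closedBall (0 : E) (s + δ), ‖h x‖ₑ ^ P) ∂ν := by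
      refine lintegral_mono_ae ?_
      filter_upwards [hsupp] with y hy
      rw [← lintegral_indicator measurableSet_closedBall,
        ← lintegral_indicator measurableSet_closedBall,
        ← lintegral_sub_right_eq_self ((closedBall (0 : E) (s + δ)).indicator _) y]
      refine lintegral_mono fun x => ?_
      by_cases hx : x ∈ closedBall (0 : E) s
      · have hxy : x - y ∈ closedBall (0 : E) (s + δ) := by
          simp only [mem_closedBall, dist_zero_right] at hx hy ⊢
          exact (norm_sub_le _ _).trans (add_le_add hx hy)
        rw [Set.indicator_of_mem hx, Set.indicator_of_mem hxy]
      · rw [Set.indicator_of_notMem hx]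
        exact zero_le
    _ = _ := by rw [lintegral_const, hν1, mul_one]

/-- Mollification commutes with weak differentiation. -/
theorem HasWeakFDerivOn.hasFDerivAt_convolution {w : E → F} {h : E → E →L[ℝ] F}
    (hw : HasWeakFDerivOn Set.univ w h) {φ : E → ℝ}
    (hφ : ContDiff ℝ ((⊤ : ℕ∞) : WithTop ℕ∞) φ) (hφc : HasCompactSupport φ) (x : E) :
    HasFDerivAt (φ ⋆[ContinuousLinearMap.lsmul ℝ ℝ, volume] w)
      ((φ ⋆[ContinuousLinearMap.lsmul ℝ ℝ, volume] h) x) x := by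
  have h1 := hφc.hasFDerivAt_convolution_left (ContinuousLinearMap.lsmul ℝ ℝ)
    (hφ.of_le (by exact_mod_cast le_top)) hw.locallyIntegrable x
  convert h1 using 1
  have e1 : Integrable (fun y => φ y • h (x - y)) volume :=
    hφc.convolutionExists_left (ContinuousLinearMap.lsmul ℝ ℝ) hφ.continuous
      hw.locallyIntegrable_deriv x
  have e2 : Integrable (fun y => (ContinuousLinearMap.lsmul ℝ ℝ).precompL E (fderiv ℝ φ y)
      (w (x - y))) volume :=
    (hφc.fderiv ℝ).convolutionExists_left _ (hφ.continuous_fderiv (by simp))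
      hw.locallyIntegrable x
  ext v
  have h2 := (hw.comp_affine (ContinuousLinearMap.id ℝ F) x
    (ContinuousLinearEquiv.neg ℝ)).integral_eq_univ hφ hφc v
  simp only [convolution_def]
  rw [ContinuousLinearMap.integral_apply e2]
  simp only [ContinuousLinearMap.lsmul_apply]
  rw [ContinuousLinearMap.integral_apply e1]
  simp only [ContinuousLinearMap.coe_id', id_eq, ContinuousLinearEquiv.coe_neg,
    ContinuousLinearMap.comp_apply, Pi.neg_apply, ← sub_eq_add_neg] at h2
  simp only [ContinuousLinearMap.precompL_apply, ContinuousLinearMap.lsmul_apply]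
  rw [h2]
  simp [integral_neg]

/-- A Poincaré-type inequality at the centre of a ball: if the `P`-th power of the weak derivative
of a continuous map has means at most `κ` on all balls of radius at most `2ρ` about the origin,
then the deviation of the map from its value at the origin is of order `ρ` in the `L^P` mean over
the ball of radius `ρ`. -/
theorem HasWeakFDerivOn.setLIntegral_sub_center_le {w : E → F} {h : E → E →L[ℝ] F}
    (hw : HasWeakFDerivOn Set.univ w h) (hwc : Continuous w) {P : ℝ} (hP : 1 ≤ P) {ρ : ℝ}
    (hρ : 0 < ρ) {κ : ℝ≥0∞} (hκ : ∀ s, 0 < s → s ≤ 2 * ρ →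
      ∫⁻ z in closedBall (0 : E) s, ‖h z‖ₑ ^ P ≤ κ * volume (closedBall (0 : E) s)) :
    ∫⁻ z in closedBall (0 : E) ρ, ‖w z - w 0‖ₑ ^ P
      ≤ ENNReal.ofReal ρ ^ P *
        (ENNReal.ofReal (2 ^ finrank ℝ E) * κ * volume (closedBall (0 : E) ρ)) := by
  have hP0 : 0 ≤ P := by linarith
  wlog hh : StronglyMeasurable h generalizing h
  · have hm := hw.locallyIntegrable_deriv.aestronglyMeasurable
    refine this (hw.congr_ae hm.ae_eq_mk) (fun s hs hs' => ?_) hm.stronglyMeasurable_mk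
    refine le_trans (le_of_eq (lintegral_congr_ae ?_)) (hκ s hs hs')
    filter_upwards [ae_restrict_of_ae hm.ae_eq_mk] with z hz
    rw [hz]
  set K : ℝ≥0∞ := ENNReal.ofReal (2 ^ finrank ℝ E) * κ * volume (closedBall (0 : E) ρ) with hK
  -- At scale `τ`, mollify with radius `τρ` and compare `z` with `τz` instead of `0`: along the
  -- segment the mollification radius stays below the distance to the origin.
  let φ : ℕ → ContDiffBump (0 : E) := fun k =>
    ⟨ρ * ((k : ℝ) + 1)⁻¹ / 2, ρ * ((k : ℝ) + 1)⁻¹, by positivity, half_lt_self (by positivity)⟩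
  have hφout : ∀ k, (φ k).rOut = ρ * ((k : ℝ) + 1)⁻¹ := fun k => rfl
  let v : ℕ → E → F := fun k =>
    (φ k).normed volume ⋆[ContinuousLinearMap.lsmul ℝ ℝ, volume] w
  have step : ∀ k : ℕ, ∫⁻ z in closedBall (0 : E) ρ,
      ‖v k z - v k (((k : ℝ) + 1)⁻¹ • z)‖ₑ ^ P ≤ ENNReal.ofReal ρ ^ P * K := by
    intro k
    set τ : ℝ := ((k : ℝ) + 1)⁻¹ with hτ
    have hτ0 : 0 < τ := by positivity
    have hτ1 : τ ≤ 1 := inv_le_one_of_one_le₀ (by linarith [(Nat.cast_nonneg k : (0 : ℝ) ≤ k)])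
    have hsm : ContDiff ℝ ((⊤ : ℕ∞) : WithTop ℕ∞) ((φ k).normed (volume : Measure E)) :=
      (φ k).contDiff_normed
    have hcs : HasCompactSupport ((φ k).normed (volume : Measure E)) :=
      (φ k).hasCompactSupport_normed
    have hv : ContDiff ℝ 1 (v k) := hcs.contDiff_convolution_left (n := 1) _
      (hsm.of_le (by exact_mod_cast le_top)) hw.locallyIntegrable
    refine (setLIntegral_sub_smul_le hv hP hτ0 hτ1).trans ?_
    gcongr
    calc ∫⁻ t in Set.Ioc τ 1, ∫⁻ z in closedBall (0 : E) ρ, ‖fderiv ℝ (v k) (t • z)‖ₑ ^ P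
        ≤ ∫⁻ _ in Set.Ioc τ 1, K := by
          refine setLIntegral_mono' measurableSet_Ioc fun t ht => ?_
          have ht0 : 0 < t := hτ0.trans ht.1
          have hsupp : Function.support ((φ k).normed (volume : Measure E))
              ⊆ closedBall 0 (ρ * τ) := by
            rw [(φ k).support_normed_eq]
            exact ball_subset_closedBall
          calc ∫⁻ z in closedBall (0 : E) ρ, ‖fderiv ℝ (v k) (t • z)‖ₑ ^ P
              = ENNReal.ofReal ((t ^ finrank ℝ E)⁻¹) *
                  ∫⁻ z in closedBall (0 : E) (t * ρ), ‖fderiv ℝ (v k) z‖ₑ ^ P :=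
                setLIntegral_closedBall_comp_smul (fun z => ‖fderiv ℝ (v k) z‖ₑ ^ P) ht0 ρ
            _ ≤ ENNReal.ofReal ((t ^ finrank ℝ E)⁻¹) *
                  ∫⁻ z in closedBall (0 : E) (t * ρ + ρ * τ), ‖h z‖ₑ ^ P := by
                refine mul_le_mul' le_rfl ?_
                have hfd : fderiv ℝ (v k) =
                    (φ k).normed volume ⋆[ContinuousLinearMap.lsmul ℝ ℝ, volume] h :=
                  funext fun z => (hw.hasFDerivAt_convolution hsm hcs z).fderiv
                rw [hfd]
                exact setLIntegral_convolution_le hh hsm.continuous (φ k).nonneg_normed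
                  (φ k).integrable_normed (φ k).integral_normed hsupp hP _
            _ ≤ ENNReal.ofReal ((t ^ finrank ℝ E)⁻¹) *
                  ∫⁻ z in closedBall (0 : E) ((2 * t) * ρ), ‖h z‖ₑ ^ P := by
                gcongr
                nlinarith [ht.1]
            _ ≤ ENNReal.ofReal ((t ^ finrank ℝ E)⁻¹) *
                  (κ * volume (closedBall (0 : E) ((2 * t) * ρ))) := by
                gcongr
                exact hκ _ (by positivity) (by nlinarith [ht.2])
            _ = K := by
                rw [Measure.addHaar_closedBall_mul _ _ (by positivity) hρ.le, hK, mul_pow,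
                  ENNReal.ofReal_mul (by positivity)]
                have : ENNReal.ofReal ((t ^ finrank ℝ E)⁻¹) * ENNReal.ofReal (t ^ finrank ℝ E)
                    = 1 := by
                  rw [← ENNReal.ofReal_mul (by positivity),
                    inv_mul_cancel₀ (by positivity), ENNReal.ofReal_one]
                calc _ = (ENNReal.ofReal ((t ^ finrank ℝ E)⁻¹) * ENNReal.ofReal (t ^ finrank ℝ E)) *
                      (ENNReal.ofReal (2 ^ finrank ℝ E) * κ * volume (closedBall (0 : E) ρ)) := by
                      ring
                  _ = _ := by rw [this, one_mul]
      _ = K * ENNReal.ofReal (1 - τ) := by rw [setLIntegral_const, Real.volume_Ioc]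
      _ ≤ K * 1 := by
          gcongr
          exact ENNReal.ofReal_le_one.2 (by linarith)
      _ = K := mul_one K
  have hτlim : Tendsto (fun k : ℕ => ((k : ℝ) + 1)⁻¹) atTop (𝓝 0) := by
    simpa [one_div] using tendsto_one_div_add_atTop_nhds_zero_nat (𝕜 := ℝ)
  have hφlim : Tendsto (fun k => (φ k).rOut) atTop (𝓝 0) := by
    simpa [hφout] using hτlim.const_mul ρ
  have hlim : ∀ z, Tendsto (fun k : ℕ => ‖v k z - v k (((k : ℝ) + 1)⁻¹ • z)‖ₑ ^ P) atTop
      (𝓝 (‖w z - w 0‖ₑ ^ P)) := by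
    intro z
    have h1 : Tendsto (fun k => v k z) atTop (𝓝 (w z)) :=
      ContDiffBump.convolution_tendsto_right_of_continuous hφlim hwc z
    have h2 : Tendsto (fun k : ℕ => v k (((k : ℝ) + 1)⁻¹ • z)) atTop (𝓝 (w 0)) := by
      refine ContDiffBump.convolution_tendsto_right (g := fun _ => w) hφlim
        (Eventually.of_forall fun _ => hwc.aestronglyMeasurable)
        ((hwc.tendsto 0).comp tendsto_snd) ?_
      simpa using hτlim.smul_const z
    exact (ENNReal.continuous_rpow_const.tendsto _).comp (h1.sub h2).enorm
  have hmeas : ∀ k : ℕ, Measurable fun z => ‖v k z - v k (((k : ℝ) + 1)⁻¹ • z)‖ₑ ^ P := by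
    intro k
    have hvc : Continuous (v k) :=
      ((φ k).hasCompactSupport_normed.contDiff_convolution_left (n := 0) _
        (φ k).contDiff_normed hw.locallyIntegrable).continuous
    have : Continuous fun z => ‖v k z - v k (((k : ℝ) + 1)⁻¹ • z)‖ₑ := by fun_prop
    exact this.measurable.pow_const P
  calc ∫⁻ z in closedBall (0 : E) ρ, ‖w z - w 0‖ₑ ^ P
      = ∫⁻ z in closedBall (0 : E) ρ,
          liminf (fun k : ℕ => ‖v k z - v k (((k : ℝ) + 1)⁻¹ • z)‖ₑ ^ P) atTop := by
        exact lintegral_congr fun z => (hlim z).liminf_eq.symm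
    _ ≤ liminf (fun k : ℕ => ∫⁻ z in closedBall (0 : E) ρ,
          ‖v k z - v k (((k : ℝ) + 1)⁻¹ • z)‖ₑ ^ P) atTop := lintegral_liminf_le hmeas
    _ ≤ ENNReal.ofReal ρ ^ P * K := by
        refine liminf_le_of_le (by isBoundedDefault) fun b hb => ?_
        obtain ⟨k, hk⟩ := hb.exists
        exact hk.trans (step k)

end Poincare

/-! ### Lebesgue points and differentiability in the mean -/

section LebesguePoints

variable {E F : Type*} [NormedAddCommGroup E] [NormedSpace ℝ E] [FiniteDimensional ℝ E]
  [MeasureSpace E] [BorelSpace E] [(volume : Measure E).IsAddHaarMeasure]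
  [NormedAddCommGroup F] [NormedSpace ℝ F] [FiniteDimensional ℝ F]

/-- Almost every point is a Lebesgue point in the sense of `L^P` means. -/
theorem ae_tendsto_mean_enorm_sub_rpow {V : Type*} [NormedAddCommGroup V]
    [SecondCountableTopology V] {h : E → V} (hm : AEStronglyMeasurable h volume) {P : ℝ}
    (hP : 1 ≤ P) (hloc : ∀ R : ℝ, ∫⁻ x in closedBall (0 : E) R, ‖h x‖ₑ ^ P ≠ ∞) :
    ∀ᵐ x ∂(volume : Measure E), Tendsto (fun r : ℝ =>
      (∫⁻ z in closedBall x r, ‖h z - h x‖ₑ ^ P) / volume (closedBall x r)) (𝓝[>] 0) (𝓝 0) := by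
  have hP0 : 0 < P := by linarith
  have hsub : ∀ a b : V, ‖a - b‖ₑ ^ P ≤ 2 ^ (P - 1) * (‖a‖ₑ ^ P + ‖b‖ₑ ^ P) := fun a b =>
    (ENNReal.rpow_le_rpow enorm_sub_le hP0.le).trans (ENNReal.rpow_add_le_mul_rpow_add_rpow _ _ hP)
  have h2 : (2 : ℝ≥0∞) ^ (P - 1) ≠ ∞ :=
    ENNReal.rpow_ne_top_of_nonneg (by linarith) ENNReal.ofNat_ne_top
  have hvtop : ∀ x : E, ∀ r, volume (closedBall x r) ≠ ∞ := fun x r =>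
    measure_closedBall_lt_top.ne
  let c : ℕ → V := TopologicalSpace.denseSeq V
  let ψ : ℕ → ℕ → E → ℝ≥0∞ := fun k i =>
    (closedBall (0 : E) k).indicator fun z => ‖h z - c i‖ₑ ^ P
  have hψ : ∀ᵐ x ∂(volume : Measure E), ∀ k i, Tendsto (fun r : ℝ =>
      (∫⁻ z in closedBall x r, ψ k i z) / volume (closedBall x r)) (𝓝[>] 0) (𝓝 (ψ k i x)) := by
    refine ae_all_iff.2 fun k => ae_all_iff.2 fun i => ?_
    have hmeas : AEMeasurable (fun z => ‖h z - c i‖ₑ ^ P) (volume : Measure E) :=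
      (hm.sub aestronglyMeasurable_const).enorm.pow_const P
    have hfin : ∫⁻ z, ψ k i z ≠ ∞ := by
      rw [lintegral_indicator measurableSet_closedBall]
      refine ne_top_of_le_ne_top ?_ (lintegral_mono fun z => hsub (h z) (c i))
      rw [lintegral_const_mul' _ _ h2, lintegral_add_right _ measurable_const, setLIntegral_const]
      exact ENNReal.mul_ne_top h2 (ENNReal.add_ne_top.2 ⟨hloc k, ENNReal.mul_ne_top
        (ENNReal.rpow_ne_top_of_nonneg hP0.le enorm_ne_top) (hvtop _ _)⟩)
    filter_upwards [(Besicovitch.vitaliFamily (volume : Measure E)).ae_tendsto_lintegral_div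
      (hmeas.indicator measurableSet_closedBall) hfin] with x hx
    exact hx.comp (Besicovitch.tendsto_filterAt volume x)
  filter_upwards [hψ] with x hx
  obtain ⟨k, hk⟩ := exists_nat_gt (‖x‖ + 1)
  have hlim : ∀ i, Tendsto (fun r : ℝ =>
      (∫⁻ z in closedBall x r, ‖h z - c i‖ₑ ^ P) / volume (closedBall x r)) (𝓝[>] 0)
      (𝓝 (‖h x - c i‖ₑ ^ P)) := by
    intro i
    have hx0 : ψ k i x = ‖h x - c i‖ₑ ^ P :=
      Set.indicator_of_mem (by simpa using (by linarith : ‖x‖ ≤ k)) _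
    rw [← hx0]
    refine (hx k i).congr' ?_
    filter_upwards [Ioc_mem_nhdsGT (zero_lt_one (α := ℝ))] with r hr
    congr 1
    refine setLIntegral_congr_fun measurableSet_closedBall fun z hz => ?_
    refine Set.indicator_of_mem ?_ _
    have h1 : ‖z - x‖ ≤ r := by simpa [dist_eq_norm] using hz
    have h2 : ‖z‖ ≤ ‖x‖ + ‖z - x‖ := norm_le_insert' z x
    simpa using (by linarith [hr.2] : ‖z‖ ≤ k)
  rw [ENNReal.tendsto_nhds_zero]
  intro ε hε
  -- choose a point of the countable dense set close to `h x`
  have hcont : Tendsto (fun a : V => 2 ^ (P - 1) * (‖h x - a‖ₑ ^ P + ‖h x - a‖ₑ ^ P)) (𝓝 (h x))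
      (𝓝 0) := by
    have h1 : Tendsto (fun a : V => ‖h x - a‖ₑ ^ P) (𝓝 (h x)) (𝓝 0) := by
      have : Continuous fun a : V => ‖h x - a‖ₑ ^ P :=
        ENNReal.continuous_rpow_const.comp (by fun_prop)
      simpa [hP0] using this.tendsto (h x)
    simpa using ENNReal.Tendsto.const_mul (h1.add h1) (Or.inr h2)
  obtain ⟨_, ⟨i, rfl⟩, ha⟩ := (TopologicalSpace.denseRange_denseSeq V).inter_nhds_nonempty
    (hcont.eventually_lt_const hε)
  have hlim2 : Tendsto (fun r : ℝ => 2 ^ (P - 1) *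
      ((∫⁻ z in closedBall x r, ‖h z - c i‖ₑ ^ P) / volume (closedBall x r)
        + ‖h x - c i‖ₑ ^ P)) (𝓝[>] 0)
      (𝓝 (2 ^ (P - 1) * (‖h x - c i‖ₑ ^ P + ‖h x - c i‖ₑ ^ P))) :=
    ENNReal.Tendsto.const_mul ((hlim i).add tendsto_const_nhds) (Or.inr h2)
  filter_upwards [hlim2.eventually_lt_const ha, self_mem_nhdsWithin] with r hr hr0
  refine le_trans ?_ hr.le
  have hv0 : volume (closedBall x r) ≠ 0 := (measure_closedBall_pos volume x hr0).ne'
  calc (∫⁻ z in closedBall x r, ‖h z - h x‖ₑ ^ P) / volume (closedBall x r)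
      ≤ (∫⁻ z in closedBall x r, 2 ^ (P - 1) * (‖h z - c i‖ₑ ^ P + ‖h x - c i‖ₑ ^ P))
          / volume (closedBall x r) := by
        gcongr with z
        have := hsub (h z - c i) (h x - c i)
        rwa [sub_sub_sub_cancel_right] at this
    _ = _ := by
        rw [lintegral_const_mul' _ _ h2, lintegral_add_right _ measurable_const,
          setLIntegral_const, mul_div_assoc, ENNReal.add_div,
          ENNReal.mul_div_cancel_right hv0 (hvtop _ _)]

/-- `x` is a point of `L^P` approximation for `u` with derivative `Du`: it is a Lebesgue point
of `Du` in the `L^P` sense, and the first order expansion of `u` at `x` with linear part `Du x`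
holds in the mean of order `P` over balls. -/
structure IsLpApproxPoint (P : ℝ) (u : E → F) (Du : E → E →L[ℝ] F) (x : E) : Prop where
  tendsto_deriv : Tendsto (fun r : ℝ =>
    (∫⁻ z in closedBall x r, ‖Du z - Du x‖ₑ ^ P) / volume (closedBall x r)) (𝓝[>] 0) (𝓝 0)
  tendsto_sub : Tendsto (fun r : ℝ =>
    (∫⁻ z in closedBall x r, ‖u z - u x - Du x (z - x)‖ₑ ^ P) /
      (ENNReal.ofReal r ^ P * volume (closedBall x r))) (𝓝[>] 0) (𝓝 0)

theorem setLIntegral_closedBall_eq_add (g : E → ℝ≥0∞) (x : E) (r : ℝ) :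
    ∫⁻ z in closedBall x r, g z = ∫⁻ y in closedBall (0 : E) r, g (x + y) := by
  have h := setLIntegral_map_of_measurableEmbedding (measurableEmbedding_addLeft x)
    (volume : Measure E) g (closedBall x r)
  rw [(measurePreserving_add_left volume x).map_eq] at h
  rw [h]
  congr 2
  ext y
  simp [dist_eq_norm]

/-- The analogue for Sobolev maps of the fact that a Lebesgue point of the derivative is a point of
differentiability. -/
theorem HasWeakFDerivOn.isLpApproxPoint {u : E → F} {Du : E → E →L[ℝ] F}
    (hu : HasWeakFDerivOn Set.univ u Du) (huc : Continuous u) {P : ℝ} (hP : 1 ≤ P) {x : E}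
    (hx : Tendsto (fun r : ℝ =>
      (∫⁻ z in closedBall x r, ‖Du z - Du x‖ₑ ^ P) / volume (closedBall x r)) (𝓝[>] 0) (𝓝 0)) :
    IsLpApproxPoint P u Du x := by
  refine ⟨hx, ?_⟩
  have hw := (hu.comp_affine (ContinuousLinearMap.id ℝ F) x
    (ContinuousLinearEquiv.refl ℝ E)).sub_affine 0 (Du x)
  simp only [ContinuousLinearMap.coe_id', id_eq, ContinuousLinearEquiv.refl_apply, zero_add,
    ContinuousLinearEquiv.coe_refl, ContinuousLinearMap.comp_id,
    ContinuousLinearMap.id_comp] at hw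
  rw [ENNReal.tendsto_nhds_zero] at hx ⊢
  intro ε hε
  set N : ℝ≥0∞ := ENNReal.ofReal (2 ^ finrank ℝ E) with hN
  have hN0 : N ≠ 0 := by
    rw [hN]
    exact (ENNReal.ofReal_pos.2 (by positivity)).ne'
  have hNt : N ≠ ∞ := ENNReal.ofReal_ne_top
  have hεN : 0 < ε / N := ENNReal.div_pos hε.ne' hNt
  obtain ⟨δ, hδ, hδs⟩ := mem_nhdsGT_iff_exists_Ioc_subset.1 (hx (ε / N) hεN)
  have hδ0 : 0 < δ := hδ
  filter_upwards [Ioc_mem_nhdsGT (half_pos hδ0)] with ρ hρ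
  have hρ0 : 0 < ρ := hρ.1
  have key := hw.setLIntegral_sub_center_le (by fun_prop) hP hρ0 (κ := ε / N) (by
    intro s hs hs2
    have h1 := hδs ⟨hs, by linarith [hρ.2]⟩
    simp only [Set.mem_ofPred_eq] at h1
    rw [← setLIntegral_closedBall_eq_add (fun z => ‖Du z - Du x‖ₑ ^ P)]
    have hvol : volume (closedBall (0 : E) s) = volume (closedBall x s) :=
      (Measure.addHaar_closedBall_center volume x s).symm
    rw [hvol]
    exact (ENNReal.div_le_iff (measure_closedBall_pos volume x hs).ne'
      measure_closedBall_lt_top.ne).1 h1)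
  rw [setLIntegral_closedBall_eq_add]
  refine ENNReal.div_le_of_le_mul ?_
  calc ∫⁻ y in closedBall (0 : E) ρ, ‖u (x + y) - u x - Du x (x + y - x)‖ₑ ^ P
      = ∫⁻ y in closedBall (0 : E) ρ, ‖u (x + y) - Du x y - (u (x + 0) - Du x 0)‖ₑ ^ P := by
        refine lintegral_congr fun y => ?_
        rw [add_zero, map_zero, sub_zero, add_sub_cancel_left, sub_right_comm]
    _ ≤ _ := key
    _ = ε * (ENNReal.ofReal ρ ^ P * volume (closedBall x ρ)) := by
        rw [ENNReal.mul_div_cancel hN0 hNt, Measure.addHaar_closedBall_center volume x ρ]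
        ring

theorem HasWeakFDerivOn.ae_isLpApproxPoint {u : E → F} {Du : E → E →L[ℝ] F}
    (hu : HasWeakFDerivOn Set.univ u Du) (huc : Continuous u) {P : ℝ} (hP : 1 ≤ P)
    (hloc : ∀ R : ℝ, ∫⁻ x in closedBall (0 : E) R, ‖Du x‖ₑ ^ P ≠ ∞) :
    ∀ᵐ x ∂(volume : Measure E), IsLpApproxPoint P u Du x := by
  have : ProperSpace (E →L[ℝ] F) := FiniteDimensional.proper_real _
  filter_upwards [ae_tendsto_mean_enorm_sub_rpow hu.locallyIntegrable_deriv.aestronglyMeasurable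
    hP hloc] with x hx
  exact hu.isLpApproxPoint huc hP hx

theorem HasWeakFDerivOn.ae_isLpApproxPoint_one {u : E → F} {Du : E → E →L[ℝ] F}
    (hu : HasWeakFDerivOn Set.univ u Du) (huc : Continuous u) :
    ∀ᵐ x ∂(volume : Measure E), IsLpApproxPoint 1 u Du x := by
  refine hu.ae_isLpApproxPoint huc le_rfl fun R => ?_
  simp only [ENNReal.rpow_one]
  have : ProperSpace E := FiniteDimensional.proper_real _
  exact (hu.locallyIntegrable_deriv.integrableOn_isCompact (isCompact_closedBall 0 R)).2.ne

end LebesguePoints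

/-! ### Classical differentiability on large sets and the derivative of the inverse -/

section Inverse

variable {E F : Type*} [NormedAddCommGroup E] [NormedSpace ℝ E] [FiniteDimensional ℝ E]
  [MeasureSpace E] [BorelSpace E] [(volume : Measure E).IsAddHaarMeasure]
  [NormedAddCommGroup F] [NormedSpace ℝ F] [FiniteDimensional ℝ F]

/-- The points where the mean oscillation of `u` over balls of radius `r < 1 / (j + 1)` is at most
`j r`. -/
def meanLipschitzSet (u : E → F) (j : ℕ) : Set E :=
  {x | ∀ r : ℝ, 0 < r → r < 1 / ((j : ℝ) + 1) →
    ∫⁻ z in closedBall (0 : E) r, ‖u (x + z) - u x‖ₑ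
      ≤ ENNReal.ofReal (j * r) * volume (closedBall (0 : E) r)}

theorem isClosed_meanLipschitzSet {u : E → F} (hu : Continuous u) (j : ℕ) :
    IsClosed (meanLipschitzSet u j) := by
  refine IsSeqClosed.isClosed fun x a hx hxa r hr hrj => ?_
  have hlim : ∀ z, Tendsto (fun k => ‖u (x k + z) - u (x k)‖ₑ) atTop
      (𝓝 ‖u (a + z) - u a‖ₑ) := fun z =>
    (((hu.tendsto _).comp (hxa.add_const z)).sub ((hu.tendsto _).comp hxa)).enorm
  calc ∫⁻ z in closedBall (0 : E) r, ‖u (a + z) - u a‖ₑ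
      = ∫⁻ z in closedBall (0 : E) r, liminf (fun k => ‖u (x k + z) - u (x k)‖ₑ) atTop :=
        lintegral_congr fun z => (hlim z).liminf_eq.symm
    _ ≤ liminf (fun k => ∫⁻ z in closedBall (0 : E) r, ‖u (x k + z) - u (x k)‖ₑ) atTop :=
        lintegral_liminf_le fun k =>
          (by fun_prop : Continuous fun z => ‖u (x k + z) - u (x k)‖ₑ).measurable
    _ ≤ _ := by
        refine liminf_le_of_le (by isBoundedDefault) fun b hb => ?_
        obtain ⟨k, hk⟩ := hb.exists
        exact hk.trans (hx k r hr hrj)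

theorem IsLpApproxPoint.eventually_setLIntegral_le {u : E → F} {Du : E → E →L[ℝ] F} {x : E}
    (h : IsLpApproxPoint 1 u Du x) {η : ℝ} (hη : 0 < η) :
    ∃ δ > 0, ∀ r, 0 < r → r ≤ δ → ∫⁻ z in closedBall x r, ‖u z - u x - Du x (z - x)‖ₑ
      ≤ ENNReal.ofReal (η * r) * volume (closedBall (0 : E) r) := by
  have h1 := ENNReal.tendsto_nhds_zero.1 h.tendsto_sub (ENNReal.ofReal η) (ENNReal.ofReal_pos.2 hη)
  obtain ⟨δ, hδ, hδs⟩ := mem_nhdsGT_iff_exists_Ioc_subset.1 h1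
  refine ⟨δ, hδ, fun r hr hrδ => ?_⟩
  have h2 := hδs ⟨hr, hrδ⟩
  simp only [Set.mem_ofPred_eq, ENNReal.rpow_one] at h2
  rw [ENNReal.div_le_iff (mul_ne_zero (ENNReal.ofReal_pos.2 hr).ne'
    (measure_closedBall_pos volume x hr).ne')
    (ENNReal.mul_ne_top ENNReal.ofReal_ne_top measure_closedBall_lt_top.ne), ← mul_assoc,
    ← ENNReal.ofReal_mul hη.le, Measure.addHaar_closedBall_center volume x r] at h2
  exact h2

theorem IsLpApproxPoint.exists_mem_meanLipschitzSet {u : E → F} {Du : E → E →L[ℝ] F} {x : E}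
    (h : IsLpApproxPoint 1 u Du x) : ∃ j, x ∈ meanLipschitzSet u j := by
  obtain ⟨δ, hδ, hδs⟩ := h.eventually_setLIntegral_le one_pos
  obtain ⟨j₁, hj₁⟩ := exists_nat_gt (1 + ‖Du x‖)
  obtain ⟨j₂, hj₂⟩ := exists_nat_gt (1 / δ)
  refine ⟨max j₁ j₂, fun r hr hrj => ?_⟩
  have hj₁' : 1 + ‖Du x‖ ≤ (max j₁ j₂ : ℕ) :=
    hj₁.le.trans (by exact_mod_cast le_max_left _ _)
  have hj₂' : 1 / δ ≤ (max j₁ j₂ : ℕ) := hj₂.le.trans (by exact_mod_cast le_max_right _ _)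
  have hrδ : r ≤ δ := by
    refine hrj.le.trans ?_
    rw [div_le_comm₀ (by positivity) hδ]
    linarith
  have h1 := hδs r hr hrδ
  rw [setLIntegral_closedBall_eq_add] at h1
  simp only [add_sub_cancel_left, one_mul] at h1
  calc ∫⁻ z in closedBall (0 : E) r, ‖u (x + z) - u x‖ₑ
      ≤ ∫⁻ z in closedBall (0 : E) r,
          (‖u (x + z) - u x - Du x z‖ₑ + ENNReal.ofReal (‖Du x‖ * r)) := by
        refine setLIntegral_mono' measurableSet_closedBall fun z hz => ?_
        have hz' : ‖z‖ ≤ r := by simpa using hz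
        calc ‖u (x + z) - u x‖ₑ = ‖(u (x + z) - u x - Du x z) + Du x z‖ₑ := by
              rw [sub_add_cancel]
          _ ≤ _ := enorm_add_le _ _
          _ ≤ _ := by
              gcongr
              rw [← ofReal_norm]
              exact ENNReal.ofReal_le_ofReal (((Du x).le_opNorm z).trans (by gcongr))
    _ = (∫⁻ z in closedBall (0 : E) r, ‖u (x + z) - u x - Du x z‖ₑ)
          + ENNReal.ofReal (‖Du x‖ * r) * volume (closedBall (0 : E) r) := by
        rw [lintegral_add_right _ measurable_const, setLIntegral_const]
    _ ≤ ENNReal.ofReal r * volume (closedBall (0 : E) r)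
          + ENNReal.ofReal (‖Du x‖ * r) * volume (closedBall (0 : E) r) := by gcongr
    _ = ENNReal.ofReal ((1 + ‖Du x‖) * r) * volume (closedBall (0 : E) r) := by
        rw [← add_mul, ← ENNReal.ofReal_add hr.le (by positivity)]
        ring_nf
    _ ≤ _ := by gcongr

/-- On the set where the mean oscillation is controlled linearly, differentiability in the mean
becomes classical differentiability relative to that set. -/
theorem IsLpApproxPoint.hasFDerivWithinAt {u : E → F} {Du : E → E →L[ℝ] F} {x₀ : E}
    (hu : Continuous u) (h : IsLpApproxPoint 1 u Du x₀) (j : ℕ) :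
    HasFDerivWithinAt u (Du x₀) (meanLipschitzSet u j) x₀ := by
  refine HasFDerivWithinAt.of_isLittleO (Asymptotics.isLittleO_iff.2 fun ε' hε' => ?_)
  set M := Du x₀ with hM
  set C : ℝ := j + ‖M‖ + 1 with hC
  have hC0 : 0 < C := by positivity
  -- compare `x` and `x₀` through the points of the ball of radius `ε ‖x - x₀‖` about `x`
  obtain ⟨ε, hε, hε1, hεC⟩ : ∃ ε : ℝ, 0 < ε ∧ ε ≤ 1 ∧ C * ε ≤ ε' := by
    refine ⟨min 1 (ε' / C), by positivity, min_le_left _ _, ?_⟩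
    calc C * min 1 (ε' / C) ≤ C * (ε' / C) := by gcongr; exact min_le_right _ _
      _ = ε' := by field_simp
  set n := finrank ℝ E with hn
  obtain ⟨δ, hδ, hδs⟩ := h.eventually_setLIntegral_le (η := ε * (ε / 2) ^ n / 2) (by positivity)
  have hnear : ∀ᶠ x in 𝓝[meanLipschitzSet u j] x₀, dist x x₀ < min (δ / 2) (1 / ((j : ℝ) + 1)) :=
    eventually_nhdsWithin_of_eventually_nhds
      (eventually_nhds_iff_ball.2 ⟨_, by positivity, fun y hy => hy⟩)
  filter_upwards [hnear, self_mem_nhdsWithin] with x hx hxS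
  rcases eq_or_ne x x₀ with rfl | hne
  · simp
  set ρ := ‖x - x₀‖ with hρ
  have hρ0 : 0 < ρ := norm_pos_iff.2 (sub_ne_zero.2 hne)
  rw [dist_eq_norm, ← hρ, lt_min_iff] at hx
  set r := ε * ρ with hr
  have hr0 : 0 < r := by positivity
  have hrρ : r ≤ ρ := by nlinarith
  set V := volume (closedBall (0 : E) r) with hV
  have hV0 : V ≠ 0 := (measure_closedBall_pos volume _ hr0).ne'
  have hVt : V ≠ ∞ := measure_closedBall_lt_top.ne
  have I1 := hxS r hr0 (hrρ.trans_lt hx.2)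
  have I2 := hδs (2 * ρ) (by positivity) (by linarith)
  have hvol : volume (closedBall (0 : E) (2 * ρ)) = ENNReal.ofReal ((2 / ε) ^ n) * V := by
    rw [hV, ← Measure.addHaar_closedBall_mul volume (0 : E) (by positivity) hr0.le]
    congr 2
    rw [hr]
    field_simp
  have I2' : ∫⁻ z in closedBall (0 : E) r, ‖u (x + z) - u x₀ - M (x + z - x₀)‖ₑ
      ≤ ENNReal.ofReal r * V := by
    rw [← setLIntegral_closedBall_eq_add (fun z => ‖u z - u x₀ - M (z - x₀)‖ₑ)]
    have hsub : closedBall x r ⊆ closedBall x₀ (2 * ρ) := by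
      refine closedBall_subset_closedBall' ?_
      rw [dist_eq_norm, ← hρ]
      linarith
    refine (lintegral_mono_set hsub).trans (I2.trans (le_of_eq ?_))
    rw [hvol, ← mul_assoc, ← ENNReal.ofReal_mul (by positivity)]
    congr 2
    have : (ε / 2) ^ n * (2 / ε) ^ n = 1 := by
      rw [← mul_pow, div_mul_div_comm, mul_comm ε 2, div_self (by positivity), one_pow]
    calc ε * (ε / 2) ^ n / 2 * (2 * ρ) * (2 / ε) ^ n
        = ε * ρ * ((ε / 2) ^ n * (2 / ε) ^ n) := by ring
      _ = r := by rw [this, mul_one]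
  have key : ‖u x - u x₀ - M (x - x₀)‖ₑ * V ≤ ENNReal.ofReal (C * ε * ρ) * V := by
    calc ‖u x - u x₀ - M (x - x₀)‖ₑ * V
        = ∫⁻ _ in closedBall (0 : E) r, ‖u x - u x₀ - M (x - x₀)‖ₑ := by
          rw [setLIntegral_const]
      _ ≤ ∫⁻ z in closedBall (0 : E) r, (‖u (x + z) - u x‖ₑ
            + (‖u (x + z) - u x₀ - M (x + z - x₀)‖ₑ + ENNReal.ofReal (‖M‖ * r))) := by
          refine setLIntegral_mono' measurableSet_closedBall fun z hz => ?_
          have hz' : ‖z‖ ≤ r := by simpa using hz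
          have e : u x - u x₀ - M (x - x₀)
              = (u (x + z) - u x₀ - M (x + z - x₀) + M z) - (u (x + z) - u x) := by
            have : M (x + z - x₀) = M (x - x₀) + M z := by rw [← map_add]; congr 1; abel
            rw [this]
            abel
          rw [e, add_comm ‖u (x + z) - u x‖ₑ]
          refine enorm_sub_le.trans ?_
          gcongr
          refine (enorm_add_le _ _).trans ?_
          gcongr
          rw [← ofReal_norm]
          exact ENNReal.ofReal_le_ofReal ((M.le_opNorm z).trans (by gcongr))
      _ = (∫⁻ z in closedBall (0 : E) r, ‖u (x + z) - u x‖ₑ)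
            + ((∫⁻ z in closedBall (0 : E) r, ‖u (x + z) - u x₀ - M (x + z - x₀)‖ₑ)
              + ENNReal.ofReal (‖M‖ * r) * V) := by
          rw [lintegral_add_left
            (by fun_prop : Continuous fun z => ‖u (x + z) - u x‖ₑ).measurable,
            lintegral_add_right _ measurable_const, setLIntegral_const]
      _ ≤ ENNReal.ofReal (j * r) * V + (ENNReal.ofReal r * V + ENNReal.ofReal (‖M‖ * r) * V) := by
          gcongr
      _ = ENNReal.ofReal (C * ε * ρ) * V := by
          rw [← add_mul, ← add_mul, ← ENNReal.ofReal_add hr0.le (by positivity),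
            ← ENNReal.ofReal_add (by positivity) (by positivity)]
          congr 2
          rw [hC, hr]
          ring
  have key2 := (ENNReal.mul_le_mul_iff_left hV0 hVt).1 key
  rw [← ofReal_norm, ENNReal.ofReal_le_ofReal_iff (by positivity)] at key2
  calc _ ≤ C * ε * ρ := key2
    _ ≤ ε' * ρ := by gcongr

/-- If `f` is a homeomorphism, differentiable relative to `S` at `a ∈ S` with invertible derivative,
then its inverse is differentiable at `f a` relative to `f '' S`. -/
theorem Homeomorph.hasFDerivWithinAt_symm_image (f : E ≃ₜ E) {L : E →L[ℝ] E} {S : Set E} {a : E}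
    (ha : a ∈ S) (hf : HasFDerivWithinAt f L S a) (hL : L.det ≠ 0) :
    DifferentiableWithinAt ℝ f.symm (f '' S) (f a) := by
  let L' := L.toContinuousLinearEquivOfDetNeZero hL
  have h1 : HasFDerivWithinAt f (L' : E →L[ℝ] E) S (f.symm (f a)) := by
    rw [f.symm_apply_apply]
    exact hf
  refine (HasFDerivWithinAt.of_local_left_inverse (g := f.symm) (f := f) (f' := L')
    (a := f a) (s := f '' S) (t := S) ?_ h1 ⟨a, ha, rfl⟩
    (Eventually.of_forall fun x => f.apply_symm_apply x)).differentiableWithinAt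
  refine f.symm.continuous.continuousWithinAt.tendsto_nhdsWithin ?_
  rintro _ ⟨y, hy, rfl⟩
  simpa using hy

/-- A Sobolev homeomorphism maps only a null part of `{det Df ≠ 0}` into a given null set: there,
up to a countable decomposition, its inverse is differentiable and so preserves null sets. -/
theorem HasWeakFDerivOn.ae_notMem_of_det_ne_zero {f : E ≃ₜ E} {Df : E → E →L[ℝ] E}
    (hf : HasWeakFDerivOn Set.univ f Df) {N : Set E} (hN : volume N = 0) :
    ∀ᵐ x ∂(volume : Measure E), (Df x).det ≠ 0 → f x ∉ N := by
  let X : ℕ → Set E := fun j =>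
    {x ∈ meanLipschitzSet f j | IsLpApproxPoint 1 f Df x ∧ (Df x).det ≠ 0 ∧ f x ∈ N}
  have hX : ∀ j, volume (X j) = 0 := by
    intro j
    have h1 : DifferentiableOn ℝ f.symm (f '' X j) := by
      rintro _ ⟨x, hx, rfl⟩
      exact f.hasFDerivWithinAt_symm_image hx
        ((hx.2.1.hasFDerivWithinAt f.continuous j).mono (Set.sep_subset _ _)) hx.2.2.1
    have h2 : volume (f '' X j) = 0 :=
      measure_mono_null (by rintro _ ⟨x, hx, rfl⟩; exact hx.2.2.2) hN
    have h3 := addHaar_image_eq_zero_of_differentiableOn_of_addHaar_eq_zero volume h1 h2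
    rwa [← Set.image_comp, f.symm_comp_self, Set.image_id] at h3
  filter_upwards [hf.ae_isLpApproxPoint_one f.continuous,
    measure_eq_zero_iff_ae_notMem.1 (measure_iUnion_null hX)] with x hx hxX hdet hxN
  obtain ⟨j, hj⟩ := hx.exists_mem_meanLipschitzSet
  exact hxX (Set.mem_iUnion.2 ⟨j, hj, hx, hdet, hxN⟩)

/-- The chain rule for a Sobolev homeomorphism and its Sobolev inverse, almost everywhere on
`{det Df ≠ 0}`. -/
theorem HasWeakFDerivOn.ae_comp_eq_id {f : E ≃ₜ E} {Df Dg : E → E →L[ℝ] E}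
    (hf : HasWeakFDerivOn Set.univ f Df) (hg : HasWeakFDerivOn Set.univ f.symm Dg) :
    ∀ᵐ x ∂(volume : Measure E), (Df x).det ≠ 0 →
      Dg (f x) ∘L Df x = ContinuousLinearMap.id ℝ E := by
  have hfa := hf.ae_isLpApproxPoint_one f.continuous
  have hga := hf.ae_notMem_of_det_ne_zero (hg.ae_isLpApproxPoint_one f.symm.continuous)
  let A : Set E := {x | (Df x).det ≠ 0}
  have hA : NullMeasurableSet A volume := by
    have h1 : AEStronglyMeasurable (fun x => (Df x).det) volume :=
      ContinuousLinearMap.continuous_det.comp_aestronglyMeasurable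
        hf.locallyIntegrable_deriv.aestronglyMeasurable
    exact h1.aemeasurable.nullMeasurable (measurableSet_singleton (0 : ℝ)).compl
  let S₀ : Set E :=
    {x | (Df x).det ≠ 0 ∧ IsLpApproxPoint 1 f Df x ∧ IsLpApproxPoint 1 f.symm Dg (f x)}
  have hAS : A =ᵐ[volume] S₀ := by
    filter_upwards [hfa, hga] with x hx hx'
    refine propext ⟨fun h => ⟨h, hx, ?_⟩, fun h => h.1⟩
    simpa using hx' h
  obtain ⟨S, hSS, hSm, hSe⟩ := (hA.congr hAS).exists_measurable_subset_ae_eq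
  let T : ℕ → ℕ → Set E := fun j k =>
    S ∩ (meanLipschitzSet f j ∩ f ⁻¹' meanLipschitzSet f.symm k)
  have hT : ∀ j k, ∀ᵐ x ∂(volume : Measure E), x ∈ T j k →
      Dg (f x) ∘L Df x = ContinuousLinearMap.id ℝ E := by
    intro j k
    have hTm : MeasurableSet (T j k) :=
      hSm.inter ((isClosed_meanLipschitzSet f.continuous j).inter
        ((isClosed_meanLipschitzSet f.symm.continuous k).preimage f.continuous)).measurableSet
    have h1 : ApproximatesLinearOn (id : E → E) (ContinuousLinearMap.id ℝ E) (T j k) 0 := by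
      intro x _ y _
      simp
    have h2 : ∀ x ∈ T j k, HasFDerivWithinAt (id : E → E) (Dg (f x) ∘L Df x) (T j k) x := by
      intro x hx
      have hx0 := hSS hx.1
      have d1 : HasFDerivWithinAt f (Df x) (T j k) x :=
        (hx0.2.1.hasFDerivWithinAt f.continuous j).mono fun y hy => hy.2.1
      have d2 := hx0.2.2.hasFDerivWithinAt f.symm.continuous k
      have d3 := d2.comp x d1 fun y hy => hy.2.2
      rwa [f.symm_comp_self] at d3
    have h3 := h1.norm_fderiv_sub_le volume hTm _ h2
    rw [ae_restrict_iff' hTm] at h3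
    filter_upwards [h3] with x hx hxT
    have := hx hxT
    rw [nonpos_iff_eq_zero, nnnorm_eq_zero] at this
    exact sub_eq_zero.1 this
  filter_upwards [hAS.mem_iff, hSe.mem_iff, ae_all_iff.2 fun j => ae_all_iff.2 (hT j)]
    with x h1 h2 h3 hdet
  have hxS0 : x ∈ S₀ := h1.1 hdet
  obtain ⟨j, hj⟩ := hxS0.2.1.exists_mem_meanLipschitzSet
  obtain ⟨k, hk⟩ := hxS0.2.2.exists_mem_meanLipschitzSet
  exact h3 j k ⟨h2.2 hxS0, hj, hk⟩

end Inverse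

/-! ### Convergence of the rescalings -/

section Rescaling

variable {E : Type*} [NormedAddCommGroup E] [NormedSpace ℝ E] [FiniteDimensional ℝ E]
  [MeasureSpace E] [BorelSpace E] [(volume : Measure E).IsAddHaarMeasure]

theorem setLIntegral_ball_comp_affine_le (g : E → ℝ≥0∞) (x₀ : E) (T : E ≃L[ℝ] E) {r : ℝ}
    (hr : 0 < r) :
    ∫⁻ x in ball (0 : E) 1, g (x₀ + r • T x)
      ≤ ENNReal.ofReal |(LinearMap.det (T : E →ₗ[ℝ] E))⁻¹| *
        volume (closedBall (0 : E) (‖(T : E →L[ℝ] E)‖ + 1)) *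
        ((∫⁻ z in closedBall x₀ (r * (‖(T : E →L[ℝ] E)‖ + 1)), g z) /
          volume (closedBall x₀ (r * (‖(T : E →L[ℝ] E)‖ + 1)))) := by
  set K := ‖(T : E →L[ℝ] E)‖ + 1 with hK
  have hK0 : 0 < K := by positivity
  set d := ENNReal.ofReal |(LinearMap.det (T : E →ₗ[ℝ] E))⁻¹| with hd
  set V := volume (closedBall (0 : E) K) with hV
  have hV0 : V ≠ 0 := (measure_closedBall_pos volume _ hK0).ne'
  have hVt : V ≠ ∞ := measure_closedBall_lt_top.ne
  have hmap := setLIntegral_map_of_measurableEmbedding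
    (translateCompHomeomorph (0 : E) T).measurableEmbedding volume
    (fun y => g (x₀ + r • y)) (closedBall (0 : E) K)
  rw [map_translateCompHomeomorph_volume, Measure.restrict_smul, lintegral_smul_measure] at hmap
  simp only [translateCompHomeomorph_apply, zero_add, smul_eq_mul] at hmap
  have hsub : ball (0 : E) 1 ⊆ translateCompHomeomorph (0 : E) T ⁻¹' closedBall (0 : E) K := by
    intro x hx
    have hx1 : ‖x‖ < 1 := by simpa using hx
    have h1 : ‖T x‖ ≤ ‖(T : E →L[ℝ] E)‖ * ‖x‖ := (T : E →L[ℝ] E).le_opNorm x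
    simp only [Set.mem_preimage, translateCompHomeomorph_apply, zero_add, mem_closedBall,
      dist_zero_right]
    nlinarith [norm_nonneg (T : E →L[ℝ] E)]
  have hvol : volume (closedBall x₀ (r * K)) = ENNReal.ofReal (r ^ finrank ℝ E) * V :=
    Measure.addHaar_closedBall_mul volume x₀ hr.le hK0.le
  have hrn : 0 < r ^ finrank ℝ E := by positivity
  calc ∫⁻ x in ball (0 : E) 1, g (x₀ + r • T x)
      ≤ d * ∫⁻ y in closedBall (0 : E) K, g (x₀ + r • y) := by
        rw [hd, hmap]
        exact lintegral_mono_set hsub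
    _ = d * (ENNReal.ofReal ((r ^ finrank ℝ E)⁻¹) * ∫⁻ z in closedBall x₀ (r * K), g z) := by
        rw [setLIntegral_closedBall_comp_smul (fun y => g (x₀ + y)) hr,
          setLIntegral_closedBall_eq_add g x₀]
    _ = _ := by
        rw [hvol, ENNReal.ofReal_inv_of_pos hrn, ENNReal.div_eq_inv_mul,
          ENNReal.mul_inv (Or.inr hVt) (Or.inr hV0)]
        calc _ = d * (V * V⁻¹) * ((ENNReal.ofReal (r ^ finrank ℝ E))⁻¹
                  * ∫⁻ z in closedBall x₀ (r * K), g z) := by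
              rw [ENNReal.mul_inv_cancel hV0 hVt, mul_one]
          _ = _ := by ring

theorem sobolevENorm_le {p : ℝ≥0∞} (hp : 1 ≤ p) (hp_top : p ≠ ⊤) {Ω : Set E} {w : E → E}
    {Dw : E → E →L[ℝ] E} (hw : HasWeakFDerivOn Ω w Dw) :
    sobolevENorm p Ω w ≤ ((∫⁻ x in Ω, ‖w x‖ₑ ^ p.toReal) + ∫⁻ x in Ω, ‖Dw x‖ₑ ^ p.toReal)
      ^ (1 / p.toReal) := by
  have hp0 : p ≠ 0 := (zero_lt_one.trans_le hp).ne'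
  have hP0 : 0 < p.toReal := ENNReal.toReal_pos hp0 hp_top
  refine (iInf₂_le Dw hw).trans (le_of_eq ?_)
  rw [eLpNorm_eq_lintegral_rpow_enorm_toReal hp0 hp_top,
    eLpNorm_eq_lintegral_rpow_enorm_toReal hp0 hp_top, ← ENNReal.rpow_mul, ← ENNReal.rpow_mul,
    one_div_mul_cancel hP0.ne', ENNReal.rpow_one, ENNReal.rpow_one]

/-- At an `L^p` approximation point, the rescalings converge to the derivative in `W^{1,p}` of the
unit ball; this is stated after composition with linear maps on both sides. -/
theorem IsLpApproxPoint.tendsto_sobolevENorm_blowUp {p : ℝ≥0∞} (hp : 1 ≤ p) (hp_top : p ≠ ⊤)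
    {u : E → E} {Du : E → E →L[ℝ] E} (hu : HasWeakFDerivOn Set.univ u Du) {x₀ : E}
    (hx₀ : IsLpApproxPoint p.toReal u Du x₀) (B : E →L[ℝ] E) (T : E ≃L[ℝ] E) :
    Tendsto (fun r : ℝ => sobolevENorm p (ball 0 1)
      (fun x => B (blowUp u x₀ r (T x)) - B (Du x₀ (T x)))) (𝓝[>] 0) (𝓝 0) := by
  set P := p.toReal with hP
  have hp0 : p ≠ 0 := (zero_lt_one.trans_le hp).ne'
  have hP0 : 0 < P := ENNReal.toReal_pos hp0 hp_top
  set M := Du x₀ with hM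
  set K := ‖(T : E →L[ℝ] E)‖ + 1 with hK
  have hK0 : 0 < K := by positivity
  set C := ENNReal.ofReal |(LinearMap.det (T : E →ₗ[ℝ] E))⁻¹| *
    volume (closedBall (0 : E) K) with hC
  have hCt : C ≠ ∞ := ENNReal.mul_ne_top ENNReal.ofReal_ne_top measure_closedBall_lt_top.ne
  have hKlim : Tendsto (fun r : ℝ => r * K) (𝓝[>] 0) (𝓝[>] 0) := by
    refine tendsto_nhdsWithin_iff.2 ⟨?_, ?_⟩
    · have : Tendsto (fun r : ℝ => r * K) (𝓝 0) (𝓝 (0 * K)) := tendsto_id.mul_const K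
      rw [zero_mul] at this
      exact this.mono_left nhdsWithin_le_nhds
    · filter_upwards [self_mem_nhdsWithin] with r hr
      exact mul_pos hr hK0
  let a : ℝ → ℝ≥0∞ := fun r => (‖B‖ₑ * ENNReal.ofReal K) ^ P * C *
    ((∫⁻ z in closedBall x₀ (r * K), ‖u z - u x₀ - M (z - x₀)‖ₑ ^ P) /
      (ENNReal.ofReal (r * K) ^ P * volume (closedBall x₀ (r * K))))
  let b : ℝ → ℝ≥0∞ := fun r => (‖B‖ₑ * ‖(T : E →L[ℝ] E)‖ₑ) ^ P * C *
    ((∫⁻ z in closedBall x₀ (r * K), ‖Du z - M‖ₑ ^ P) / volume (closedBall x₀ (r * K)))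
  have ha : Tendsto a (𝓝[>] 0) (𝓝 0) := by
    have := ENNReal.Tendsto.const_mul (a := (‖B‖ₑ * ENNReal.ofReal K) ^ P * C)
      (hx₀.tendsto_sub.comp hKlim) (Or.inr (ENNReal.mul_ne_top (ENNReal.rpow_ne_top_of_nonneg hP0.le
        (ENNReal.mul_ne_top enorm_ne_top ENNReal.ofReal_ne_top)) hCt))
    rwa [mul_zero] at this
  have hb : Tendsto b (𝓝[>] 0) (𝓝 0) := by
    have := ENNReal.Tendsto.const_mul (a := (‖B‖ₑ * ‖(T : E →L[ℝ] E)‖ₑ) ^ P * C)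
      (hx₀.tendsto_deriv.comp hKlim) (Or.inr (ENNReal.mul_ne_top (ENNReal.rpow_ne_top_of_nonneg
        hP0.le (ENNReal.mul_ne_top enorm_ne_top enorm_ne_top)) hCt))
    rwa [mul_zero] at this
  have hab : Tendsto (fun r => (a r + b r) ^ (1 / P)) (𝓝[>] 0) (𝓝 0) := by
    have := (ENNReal.continuous_rpow_const (y := 1 / P)).tendsto (0 + 0) |>.comp (ha.add hb)
    rwa [add_zero, ENNReal.zero_rpow_of_pos (by positivity)] at this
  refine tendsto_of_tendsto_of_tendsto_of_le_of_le' tendsto_const_nhds hab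
    (Eventually.of_forall fun _ => zero_le) ?_
  filter_upwards [self_mem_nhdsWithin] with r hr
  have hr0 : (0 : ℝ) < r := hr
  let Tr : E ≃L[ℝ] E := T.trans (ContinuousLinearEquiv.smulLeft (Units.mk0 r hr0.ne'))
  have hTr : ∀ x, Tr x = r • T x := fun x => rfl
  have hw := ((hu.comp_affine (r⁻¹ • B) x₀ Tr).sub_affine (B (r⁻¹ • u x₀))
    (B ∘L M ∘L (T : E →L[ℝ] E))).restrict (ball 0 1)
  have hwe : (fun x => (r⁻¹ • B) (u (x₀ + Tr x)) - (B (r⁻¹ • u x₀) + (B ∘L M ∘L (T : E →L[ℝ] E)) x))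
      = fun x => B (blowUp u x₀ r (T x)) - B (M (T x)) := by
    funext x
    simp only [blowUp, hTr, smul_apply, map_smul, map_sub, smul_sub,
      ContinuousLinearMap.comp_apply, ContinuousLinearEquiv.coe_coe]
    abel
  rw [hwe] at hw
  refine (sobolevENorm_le hp hp_top hw).trans ?_
  gcongr
  · calc ∫⁻ x in ball (0 : E) 1, ‖B (blowUp u x₀ r (T x)) - B (M (T x))‖ₑ ^ P
        ≤ ∫⁻ x in ball (0 : E) 1, (‖B‖ₑ * ENNReal.ofReal r⁻¹) ^ P *
            ‖u (x₀ + r • T x) - u x₀ - M (x₀ + r • T x - x₀)‖ₑ ^ P := by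
          refine lintegral_mono fun x => ?_
          rw [← ENNReal.mul_rpow_of_nonneg _ _ hP0.le]
          gcongr
          have e : B (blowUp u x₀ r (T x)) - B (M (T x))
              = B (r⁻¹ • (u (x₀ + r • T x) - u x₀ - M (x₀ + r • T x - x₀))) := by
            rw [add_sub_cancel_left, map_smul M, smul_sub, smul_smul, inv_mul_cancel₀ hr0.ne',
              one_smul, map_sub]
            rfl
          rw [e]
          refine (B.le_opENorm _).trans (le_of_eq ?_)
          rw [enorm_smul, Real.enorm_eq_ofReal (by positivity), mul_assoc]
      _ = (‖B‖ₑ * ENNReal.ofReal r⁻¹) ^ P * ∫⁻ x in ball (0 : E) 1,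
            ‖u (x₀ + r • T x) - u x₀ - M (x₀ + r • T x - x₀)‖ₑ ^ P :=
          lintegral_const_mul' _ _ (ENNReal.rpow_ne_top_of_nonneg hP0.le
            (ENNReal.mul_ne_top enorm_ne_top ENNReal.ofReal_ne_top))
      _ ≤ (‖B‖ₑ * ENNReal.ofReal r⁻¹) ^ P * (C *
            ((∫⁻ z in closedBall x₀ (r * K), ‖u z - u x₀ - M (z - x₀)‖ₑ ^ P) /
              volume (closedBall x₀ (r * K)))) := by
          gcongr
          exact setLIntegral_ball_comp_affine_le
            (fun z => ‖u z - u x₀ - M (z - x₀)‖ₑ ^ P) x₀ T hr0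
      _ = a r := by
          have hrK : ENNReal.ofReal (r * K) ^ P ≠ 0 :=
            (ENNReal.rpow_pos (ENNReal.ofReal_pos.2 (by positivity)) ENNReal.ofReal_ne_top).ne'
          have hrKt : ENNReal.ofReal (r * K) ^ P ≠ ∞ :=
            ENNReal.rpow_ne_top_of_nonneg hP0.le ENNReal.ofReal_ne_top
          have h1 : (‖B‖ₑ * ENNReal.ofReal r⁻¹) ^ P
              = (‖B‖ₑ * ENNReal.ofReal K) ^ P * (ENNReal.ofReal (r * K) ^ P)⁻¹ := by
            rw [← ENNReal.inv_rpow, ← ENNReal.mul_rpow_of_nonneg _ _ hP0.le,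
              ← ENNReal.ofReal_inv_of_pos (by positivity), mul_assoc,
              ← ENNReal.ofReal_mul hK0.le]
            congr 3
            field_simp
          simp only [a]
          rw [h1, ENNReal.div_eq_inv_mul, ENNReal.div_eq_inv_mul,
            ENNReal.mul_inv (Or.inl hrK) (Or.inl hrKt)]
          ring
  · calc ∫⁻ x in ball (0 : E) 1, ‖(r⁻¹ • B) ∘L Du (x₀ + Tr x) ∘L (Tr : E →L[ℝ] E)
            - B ∘L M ∘L (T : E →L[ℝ] E)‖ₑ ^ P
        ≤ ∫⁻ x in ball (0 : E) 1, (‖B‖ₑ * ‖(T : E →L[ℝ] E)‖ₑ) ^ P *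
            ‖Du (x₀ + r • T x) - M‖ₑ ^ P := by
          refine lintegral_mono fun x => ?_
          rw [← ENNReal.mul_rpow_of_nonneg _ _ hP0.le]
          gcongr
          have e : (r⁻¹ • B) ∘L Du (x₀ + Tr x) ∘L (Tr : E →L[ℝ] E) - B ∘L M ∘L (T : E →L[ℝ] E)
              = B ∘L (Du (x₀ + r • T x) - M) ∘L (T : E →L[ℝ] E) := by
            ext y
            simp only [sub_apply, ContinuousLinearMap.comp_apply, smul_apply,
              ContinuousLinearEquiv.coe_coe, hTr, map_smul, map_sub, smul_smul,
              mul_inv_cancel₀ hr0.ne', one_smul]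
          rw [e]
          simp only [← ofReal_norm]
          rw [← ENNReal.ofReal_mul (by positivity), ← ENNReal.ofReal_mul (by positivity)]
          refine ENNReal.ofReal_le_ofReal ?_
          calc ‖B ∘L (Du (x₀ + r • T x) - M) ∘L (T : E →L[ℝ] E)‖
              ≤ ‖B‖ * ‖(Du (x₀ + r • T x) - M) ∘L (T : E →L[ℝ] E)‖ :=
                ContinuousLinearMap.opNorm_comp_le _ _
            _ ≤ ‖B‖ * (‖Du (x₀ + r • T x) - M‖ * ‖(T : E →L[ℝ] E)‖) := by
                gcongr
                exact ContinuousLinearMap.opNorm_comp_le _ _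
            _ = _ := by ring
      _ = (‖B‖ₑ * ‖(T : E →L[ℝ] E)‖ₑ) ^ P * ∫⁻ x in ball (0 : E) 1,
            ‖Du (x₀ + r • T x) - M‖ₑ ^ P :=
          lintegral_const_mul' _ _ (ENNReal.rpow_ne_top_of_nonneg hP0.le
            (ENNReal.mul_ne_top enorm_ne_top enorm_ne_top))
      _ ≤ (‖B‖ₑ * ‖(T : E →L[ℝ] E)‖ₑ) ^ P * (C *
            ((∫⁻ z in closedBall x₀ (r * K), ‖Du z - M‖ₑ ^ P) /
              volume (closedBall x₀ (r * K)))) := by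
          gcongr
          exact setLIntegral_ball_comp_affine_le (fun z => ‖Du z - M‖ₑ ^ P) x₀ T hr0
      _ = b r := by
          exact (mul_assoc _ _ _).symm

/-- Sobolev maps have `L^p` approximation points almost everywhere, for any weak derivative. -/
theorem HasWeakFDerivOn.ae_isLpApproxPoint_of_memSobolevLoc {p : ℝ≥0∞} (hp : 1 ≤ p)
    (hp_top : p ≠ ⊤) {u : E → E} (huc : Continuous u) (hmem : MemSobolevLoc p Set.univ u)
    {Du : E → E →L[ℝ] E} (hu : HasWeakFDerivOn Set.univ u Du) :
    ∀ᵐ x ∂(volume : Measure E), IsLpApproxPoint p.toReal u Du x := by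
  have hp0 : p ≠ 0 := (zero_lt_one.trans_le hp).ne'
  have hP : 1 ≤ p.toReal := by
    have := (ENNReal.toReal_le_toReal ENNReal.one_ne_top hp_top).2 hp
    simpa using this
  obtain ⟨D, hD, hDp⟩ := hmem
  have hDu := hu.ae_eq hD
  have : ProperSpace E := FiniteDimensional.proper_real _
  refine hu.ae_isLpApproxPoint huc hP fun R => ?_
  have h1 := (hDp (closedBall 0 R) (Set.subset_univ _) (isCompact_closedBall 0 R)).2
  have h2 := (lintegral_rpow_enorm_lt_top_of_eLpNorm_lt_top hp0 hp_top h1.2).ne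
  refine ne_of_eq_of_ne (lintegral_congr_ae ?_) h2
  filter_upwards [ae_restrict_of_ae hDu] with x hx
  rw [hx]

theorem invFun_blowUp_comp (f : E ≃ₜ E) (T : E ≃L[ℝ] E) (x₀ : E) {r : ℝ} (hr : 0 < r) :
    Function.invFun (blowUp ((T.symm : E →L[ℝ] E) ∘ f) x₀ r)
      = fun y => blowUp f.symm (f x₀) r (T y) := by
  have hbij : Function.Bijective (blowUp ((T.symm : E →L[ℝ] E) ∘ f) x₀ r) :=
    blowUp_bijective (T.symm.bijective.comp f.bijective) x₀ hr
  funext y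
  have h : blowUp ((T.symm : E →L[ℝ] E) ∘ f) x₀ r (blowUp f.symm (f x₀) r (T y)) = y := by
    simp [blowUp, smul_smul, hr.ne']
  conv_lhs => rw [← h]
  exact Function.leftInverse_invFun hbij.1 _

end Rescaling

/-! ### The reflection -/

theorem lastReflection_comp_self (n : ℕ) :
    lastReflection n ∘L lastReflection n = ContinuousLinearMap.id ℝ _ := by
  have h : lastReflection n * lastReflection n = 1 := by
    rw [lastReflection, ← map_mul, Matrix.diagonal_mul_diagonal]
    have : (fun i : Fin n => (if (i : ℕ) + 1 = n then (-1 : ℝ) else 1) *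
        (if (i : ℕ) + 1 = n then (-1 : ℝ) else 1)) = fun _ => 1 := by
      funext i
      split_ifs <;> simp
    rw [this, Matrix.diagonal_one, map_one]
  exact h

theorem det_lastReflection {n : ℕ} (hn : 1 ≤ n) : (lastReflection n).det = -1 := by
  have h1 : (lastReflection n).det
      = (Matrix.diagonal fun i : Fin n => if (i : ℕ) + 1 = n then (-1 : ℝ) else 1).det :=
    LinearMap.det_toLin (EuclideanSpace.basisFun (Fin n) ℝ).toBasis _
  rw [h1, Matrix.det_diagonal, Finset.prod_eq_single (⟨n - 1, by omega⟩ : Fin n)]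
  · simp [Nat.sub_add_cancel hn]
  · intro i _ hi
    rw [if_neg]
    intro h
    exact hi (Fin.ext (by simp; omega))
  · simp

/-! ### Blow-up at almost every point of negative Jacobian -/

theorem mainTheorem7 (n : ℕ) (hn : 1 ≤ n) (p q : ENNReal)
    (hp : 1 ≤ p) (hp_top : p ≠ ⊤) (hq : 1 ≤ q) (hq_top : q ≠ ⊤)
    (f : EuclideanSpace ℝ (Fin n) ≃ₜ EuclideanSpace ℝ (Fin n))
    (hf : MemSobolevLoc p Set.univ (f : EuclideanSpace ℝ (Fin n) → EuclideanSpace ℝ (Fin n)))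
    (hf_inv : MemSobolevLoc q Set.univ
      (f.symm : EuclideanSpace ℝ (Fin n) → EuclideanSpace ℝ (Fin n)))
    (Df : EuclideanSpace ℝ (Fin n) → EuclideanSpace ℝ (Fin n) →L[ℝ] EuclideanSpace ℝ (Fin n))
    (hDf : HasWeakFDerivOn Set.univ
      (f : EuclideanSpace ℝ (Fin n) → EuclideanSpace ℝ (Fin n)) Df) :
    ∀ᵐ x₀ ∂(volume : Measure (EuclideanSpace ℝ (Fin n))), (Df x₀).det < 0 →
      ∃ A : EuclideanSpace ℝ (Fin n) →L[ℝ] EuclideanSpace ℝ (Fin n), 0 < A.det ∧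
        Tendsto (fun r : ℝ => sobolevENorm p (Metric.ball 0 1)
            (fun x => blowUp (A ∘ f) x₀ r x - lastReflection n x)) (𝓝[>] 0) (𝓝 0) ∧
        Tendsto (fun r : ℝ => sobolevENorm q (Metric.ball 0 1)
            (fun x => Function.invFun (blowUp (A ∘ f) x₀ r) x - lastReflection n x)) (𝓝[>] 0) (𝓝 0) := by
  have hfm := hDf.ae_isLpApproxPoint_of_memSobolevLoc hp hp_top f.continuous hf
  obtain ⟨Dg, hDg, -⟩ := id hf_inv
  have hgm := hDg.ae_isLpApproxPoint_of_memSobolevLoc hq hq_top f.symm.continuous hf_inv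
  filter_upwards [hfm, hDf.ae_notMem_of_det_ne_zero hgm, hDf.ae_comp_eq_id hDg]
    with x₀ hx₀ hy₀ hinv hdet
  replace hinv := hinv hdet.ne
  replace hy₀ : IsLpApproxPoint q.toReal f.symm Dg (f x₀) := by simpa using hy₀ hdet.ne
  have hRR : ∀ x, lastReflection n (lastReflection n x) = x := fun x =>
    DFunLike.congr_fun (lastReflection_comp_self n) x
  have hgf : ∀ x, Dg (f x₀) (Df x₀ x) = x := fun x => DFunLike.congr_fun hinv x
  -- `T = Df x₀ ∘ R`, and the linear map of the statement is `T⁻¹ = R ∘ (Df x₀)⁻¹`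
  let R : EuclideanSpace ℝ (Fin n) ≃L[ℝ] EuclideanSpace ℝ (Fin n) :=
    ContinuousLinearEquiv.equivOfInverse (lastReflection n) (lastReflection n) hRR hRR
  let T : EuclideanSpace ℝ (Fin n) ≃L[ℝ] EuclideanSpace ℝ (Fin n) :=
    R.trans ((Df x₀).toContinuousLinearEquivOfDetNeZero hdet.ne)
  have hT : ∀ x, T x = Df x₀ (lastReflection n x) := fun x => rfl
  have hTs : ∀ x, T.symm (Df x₀ x) = lastReflection n x := by
    intro x
    rw [T.symm_apply_eq, hT, hRR]
  refine ⟨T.symm, ?_, ?_, ?_⟩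
  · have h1 : (T.symm : EuclideanSpace ℝ (Fin n) →L[ℝ] EuclideanSpace ℝ (Fin n)) ∘L Df x₀
        = lastReflection n := by
      ext1 x
      exact hTs x
    have h2 : (T.symm : EuclideanSpace ℝ (Fin n) →L[ℝ] EuclideanSpace ℝ (Fin n)).det
        * (Df x₀).det = -1 := by
      rw [← det_lastReflection hn, ← h1]
      exact (LinearMap.det_comp _ _).symm
    by_contra hneg
    nlinarith [mul_nonneg_of_nonpos_of_nonpos (not_lt.1 hneg) hdet.le]
  · have h := hx₀.tendsto_sobolevENorm_blowUp hp hp_top hDf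
      (T.symm : EuclideanSpace ℝ (Fin n) →L[ℝ] EuclideanSpace ℝ (Fin n))
      (ContinuousLinearEquiv.refl ℝ _)
    refine h.congr fun r => ?_
    congr 1
    funext x
    simp [blowUp, hTs]
  · have h := hy₀.tendsto_sobolevENorm_blowUp hq hq_top hDg (ContinuousLinearMap.id ℝ _) T
    refine h.congr' ?_
    filter_upwards [self_mem_nhdsWithin] with r hr
    rw [invFun_blowUp_comp f T x₀ hr]
    simp [hT, hgf]
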